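/- Let $\phi\in C^\infty([0,\infty))$ satisfy $4t\,\phi'(t)^2<1$ for all $t\ge 0$, and let $\mathcal W$ be the class of immersed oriented smooth surfaces in $\mathbb H^2\times\mathbb R$ whose mean curvature $H=(\kappa_1+\kappa_2)/2$ and extrinsic curvature $K_e=\kappa_1\kappa_2$ satisfy the elliptic Weingarten equation $H=\phi(H^2-K_e)$, where $\kappa_1,\kappa_2$ are the principal curvatures. Let $S$ be the canonical rotational example of $\mathcal W$, that is, a connected surface of $\mathcal W$ that is rotational about a vertical geodesic $\{q\}\times\mathbb R$, meets this axis orthogonally at some point, and is inextendible (it is not a proper open piece of a larger connected surface of $\mathcal W$ that is rotational about the same axis). Then the norm $|\sigma|=(\kappa_1^2+\kappa_2^2)^{1/2}$ of the second fundamental form of $S$ is bounded: there is a constant $C$ with $|\sigma|\le C$ on $S$. -/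

import Mathlib

open scoped Manifold ContDiff

universe u

noncomputable section

namespace WeingartenH2R

/-- The underlying vector space of the Minkowski space `𝕃⁴`. -/
abbrev L4 : Type := Fin 4 → ℝ

/-- The Lorentzian product of `𝕃⁴`, with signature `(+, +, -, +)`. -/
def lor (x y : L4) : ℝ := x 0 * y 0 + x 1 * y 1 - x 2 * y 2 + x 3 * y 3

/-- `ℍ² × ℝ`, where `ℍ²` is the upper sheet of the hyperboloid `x₀² + x₁² - x₂² = -1`. Its Riemannian
metric is the restriction of `lor` to its tangent spaces. -/
def H2R : Set L4 := {x | x 0 ^ 2 + x 1 ^ 2 - x 2 ^ 2 = -1 ∧ 0 < x 2}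

/-- The component in `ℍ²` of a point of `ℍ² × ℝ`. At `x ∈ ℍ² × ℝ` this vector spans the
`lor`-orthogonal complement in `𝕃⁴` of the tangent space of `ℍ² × ℝ` at `x`. -/
def horizontalPart (x : L4) : L4 := ![x 0, x 1, x 2, 0]

/-- The unit vertical field of `ℍ² × ℝ`. -/
def xi : L4 := ![0, 0, 0, 1]

/-- An immersed oriented smooth surface in `ℍ² × ℝ`: a smooth immersion `map` of a two-dimensional
manifold `M`, together with a smooth unit normal field `normal` (tangent to `ℍ² × ℝ`). -/
structure ImmersedSurface (M : Type u) [TopologicalSpace M]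
    [ChartedSpace (EuclideanSpace ℝ (Fin 2)) M] where
  map : M → L4
  normal : M → L4
  map_smooth : ContMDiff (𝓡 2) 𝓘(ℝ, L4) ∞ map
  normal_smooth : ContMDiff (𝓡 2) 𝓘(ℝ, L4) ∞ normal
  map_mem : ∀ p, map p ∈ H2R
  immersion : ∀ p, Function.Injective (mfderiv (𝓡 2) 𝓘(ℝ, L4) map p)
  normal_tangent : ∀ p, lor (normal p) (horizontalPart (map p)) = 0
  normal_unit : ∀ p, lor (normal p) (normal p) = 1
  normal_orth : ∀ p, ∀ v : TangentSpace (𝓡 2) p,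
    lor (normal p) (mfderiv (𝓡 2) 𝓘(ℝ, L4) map p v) = 0

namespace ImmersedSurface

variable {M : Type u} [TopologicalSpace M] [ChartedSpace (EuclideanSpace ℝ (Fin 2)) M]

/-- The vector `dψ(eᵢ)`, for the standard basis `e₀, e₁` of the tangent plane of `M` at `p`. -/
def dMap (S : ImmersedSurface M) (p : M) (i : Fin 2) : L4 :=
  mfderiv (𝓡 2) 𝓘(ℝ, L4) S.map p (EuclideanSpace.single i (1 : ℝ) : EuclideanSpace ℝ (Fin 2))

/-- The vector `dN(eᵢ)` (derivative in `𝕃⁴`), for the same basis. -/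
def dNormal (S : ImmersedSurface M) (p : M) (i : Fin 2) : L4 :=
  mfderiv (𝓡 2) 𝓘(ℝ, L4) S.normal p (EuclideanSpace.single i (1 : ℝ) : EuclideanSpace ℝ (Fin 2))

/-- The matrix of the first fundamental form at `p`. -/
def firstForm (S : ImmersedSurface M) (p : M) : Matrix (Fin 2) (Fin 2) ℝ :=
  Matrix.of fun i j => lor (S.dMap p i) (S.dMap p j)

/-- The matrix of the second fundamental form `σ(v, w) = -⟨∇_v N, dψ(w)⟩` at `p`. The Levi-Civita
connection `∇` of `ℍ² × ℝ` is the tangential part of the derivative in `𝕃⁴`, and `dψ(w)` is tangent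
to `ℍ² × ℝ`, so that the derivative in `𝕃⁴` can be used in the product. -/
def secondForm (S : ImmersedSurface M) (p : M) : Matrix (Fin 2) (Fin 2) ℝ :=
  Matrix.of fun i j => -lor (S.dNormal p i) (S.dMap p j)

/-- The matrix of the shape operator at `p`, whose eigenvalues are the principal curvatures. -/
def shape (S : ImmersedSurface M) (p : M) : Matrix (Fin 2) (Fin 2) ℝ :=
  (S.firstForm p)⁻¹ * S.secondForm p

/-- The mean curvature `H = (κ₁ + κ₂) / 2`. -/
def meanCurvature (S : ImmersedSurface M) (p : M) : ℝ := (S.shape p).trace / 2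

/-- The extrinsic curvature `K_e = κ₁ κ₂`. -/
def extrinsicCurvature (S : ImmersedSurface M) (p : M) : ℝ := (S.shape p).det

/-- The norm `|σ| = (κ₁² + κ₂²)^{1/2}` of the second fundamental form. -/
def secondFormNorm (S : ImmersedSurface M) (p : M) : ℝ :=
  Real.sqrt (S.shape p * S.shape p).trace

/-- `S` satisfies the Weingarten equation `H = φ(H² - K_e)`. -/
def IsWeingarten (S : ImmersedSurface M) (φ : ℝ → ℝ) : Prop :=
  ∀ p, S.meanCurvature p = φ (S.meanCurvature p ^ 2 - S.extrinsicCurvature p)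

end ImmersedSurface

/-- `φ ∈ C^∞([0, ∞))` and `4 t φ'(t)² < 1` for all `t ≥ 0`. -/
def IsElliptic (φ : ℝ → ℝ) : Prop :=
  ContDiffOn ℝ ∞ φ (Set.Ici 0) ∧ ∀ t : ℝ, 0 ≤ t → 4 * t * derivWithin φ (Set.Ici 0) t ^ 2 < 1

/-- `q` is a point of `ℍ² × {0}`, and `e₁, e₂` is an orthonormal basis of the horizontal vectors at
`q`. Vertical geodesics are the sets `{q} × ℝ = {q + h ξ : h ∈ ℝ}`. -/
def IsAxisFrame (q e₁ e₂ : L4) : Prop :=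
  q ∈ H2R ∧ q 3 = 0 ∧ e₁ 3 = 0 ∧ e₂ 3 = 0 ∧ lor e₁ q = 0 ∧ lor e₂ q = 0 ∧
    lor e₁ e₁ = 1 ∧ lor e₂ e₂ = 1 ∧ lor e₁ e₂ = 0

/-- The rotation of angle `t` of `ℍ² × ℝ` around the vertical geodesic `{q} × ℝ`: it fixes `q` and
the vertical direction, and rotates the plane spanned by `e₁, e₂`. -/
def axisRotation (q e₁ e₂ : L4) (t : ℝ) (x : L4) : L4 :=
  lor x e₁ • (Real.cos t • e₁ + Real.sin t • e₂) +
    lor x e₂ • (-Real.sin t • e₁ + Real.cos t • e₂) - lor x q • q + x 3 • xi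

/-- The point at signed distance `r` from the axis `{q} × ℝ` and at height `h`, in the vertical
totally geodesic plane that contains the axis and the direction `e₁`. -/
def planePoint (q e₁ : L4) (r h : ℝ) : L4 := Real.sinh r • e₁ + Real.cosh r • q + h • xi

namespace ImmersedSurface

variable {M : Type u} [TopologicalSpace M] [ChartedSpace (EuclideanSpace ℝ (Fin 2)) M]

/-- `S` is a rotational surface with axis `{q} × ℝ`, i.e. it is the image of `Ψ_t(γ(s))`, where `Ψ_t`
are the rotations around the axis and `γ = (r, h)` is an arclength-parametrized profile curve in a
vertical plane through the axis, defined on an open interval `I`. More precisely `X(s, t)` is the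
point of the abstract surface `M` with image `Ψ_t(γ(s))`. As `r` is a signed distance, `γ` is allowed
to cross the axis: for a surface that touches its axis, `γ` is the whole meridian, and `s` runs
through both sides of the axis. -/
def IsRotationalAbout (S : ImmersedSurface M) (q : L4) : Prop :=
  ∃ (e₁ e₂ : L4) (I : Set ℝ) (r h : ℝ → ℝ) (X : ℝ × ℝ → M),
    IsAxisFrame q e₁ e₂ ∧ IsOpen I ∧ I.OrdConnected ∧
    ContDiffOn ℝ ∞ r I ∧ ContDiffOn ℝ ∞ h I ∧
    (∀ s ∈ I, deriv r s ^ 2 + deriv h s ^ 2 = 1) ∧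
    ContMDiffOn 𝓘(ℝ, ℝ × ℝ) (𝓡 2) ∞ X (I ×ˢ Set.univ) ∧
    (∀ s ∈ I, ∀ t, X (s, t + 2 * Real.pi) = X (s, t)) ∧
    (∀ s ∈ I, ∀ t, S.map (X (s, t)) = axisRotation q e₁ e₂ t (planePoint q e₁ (r s) (h s))) ∧
    X '' (I ×ˢ Set.univ) = Set.univ

/-- `S` meets the vertical geodesic `{q} × ℝ` orthogonally at some point. -/
def MeetsAxisOrthogonally (S : ImmersedSurface M) (q : L4) : Prop :=
  ∃ p : M, (∃ h : ℝ, S.map p = q + h • xi) ∧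
    ∀ v : TangentSpace (𝓡 2) p, lor (mfderiv (𝓡 2) 𝓘(ℝ, L4) S.map p v) xi = 0

/-- `T` extends `S` along `ι`: `ι` identifies `S`, with its orientation, with an open piece of `T`. -/
def IsExtension {M' : Type u} [TopologicalSpace M'] [ChartedSpace (EuclideanSpace ℝ (Fin 2)) M']
    (S : ImmersedSurface M) (T : ImmersedSurface M') (ι : M → M') : Prop :=
  Topology.IsOpenEmbedding ι ∧ ContMDiff (𝓡 2) (𝓡 2) ∞ ι ∧
    (∀ p, T.map (ι p) = S.map p) ∧ ∀ p, T.normal (ι p) = S.normal p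

/-- `S` cannot be properly extended within the connected surfaces that satisfy `H = φ(H² - K_e)` and
are rotational with axis `{q} × ℝ`. -/
def IsInextendible (S : ImmersedSurface M) (φ : ℝ → ℝ) (q : L4) : Prop :=
  ∀ (M' : Type u) [TopologicalSpace M'] [ChartedSpace (EuclideanSpace ℝ (Fin 2)) M']
    [IsManifold (𝓡 2) ∞ M'] [T2Space M'] [SecondCountableTopology M'] [ConnectedSpace M']
    (T : ImmersedSurface M') (ι : M → M'),
    T.IsWeingarten φ → T.IsRotationalAbout q → S.IsExtension T ι → Function.Surjective ι

/-- `S` is a canonical rotational example of the class of surfaces with `H = φ(H² - K_e)`: an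
inextendible surface of the class that is rotational and meets its rotation axis orthogonally. -/
def IsCanonicalExample (S : ImmersedSurface M) (φ : ℝ → ℝ) : Prop :=
  S.IsWeingarten φ ∧ ∃ q : L4,
    S.IsRotationalAbout q ∧ S.MeetsAxisOrthogonally q ∧ S.IsInextendible φ q

end ImmersedSurface

end WeingartenH2R

end

noncomputable section

namespace WeingartenH2R

open Set Filter Topology

/-! The surface is governed by its profile curve, with meridian curvature `k` and parallel curvature
K = d coth r, where d = h'. Up to the sign of the normal, the Weingarten equation reads (k + K)/2 =
g(u) with u = (k - K)/2 and g(u) = ±φ(u²). Ellipticity says |g'| < 1, so k = g(u) + u increases with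
u and K = g(u) - u decreases: each curvature is a decreasing function of the other.

At an orthogonal contact with the axis both curvatures equal g(0), which may be taken nonnegative.
While r grows, the Codazzi equation K' = r' coth r (k - K/cosh² r) and this monotonicity give 0 ≤ k
≤ g(0) ≤ K (`ascending_umbilic_le`, `ascending_div_cosh_sq_le`). The bound on `k` controls how fast
the curve turns, hence d/r, hence K (`ascending_bounds`).

If r stops growing, the tangent is vertical there, and uniqueness for the profile ODE makes the
curve symmetric about that point (`symm_of_vertical`). The descending arc thus inherits the bounds
and can only reach the axis orthogonally again. Chaining such arcs (`bounds_right`, `bounds`) bounds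
both curvatures off the axis by 1 + 4|φ(0)|; on the axis the surface is umbilic with |κ| = |φ(0)|.
-/

/-! ### Profile curves and elliptic relations. -/

/-- The Frenet system of a unit speed curve `(r, h)` on `I`, where `c = r'`, `d = h'` and `k` is the
signed curvature. -/
structure IsProfile (I : Set ℝ) (r c d k : ℝ → ℝ) : Prop where
  hasDerivAt_r : ∀ s ∈ I, HasDerivAt r (c s) s
  hasDerivAt_c : ∀ s ∈ I, HasDerivAt c (-(k s * d s)) s
  hasDerivAt_d : ∀ s ∈ I, HasDerivAt d (k s * c s) s
  differentiableAt_k : ∀ s ∈ I, DifferentiableAt ℝ k s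
  unit : ∀ s ∈ I, c s ^ 2 + d s ^ 2 = 1

/-- The curvature of the parallels of a rotational surface, extended to the axis by the curvature of
the meridian. -/
def parallelCurv (r d k : ℝ → ℝ) (s : ℝ) : ℝ :=
  if r s = 0 then k s else d s * Real.cosh (r s) / Real.sinh (r s)

theorem parallelCurv_of_ne {r d k : ℝ → ℝ} {s : ℝ} (h : r s ≠ 0) :
    parallelCurv r d k s = d s * Real.cosh (r s) / Real.sinh (r s) := if_neg h

theorem parallelCurv_of_eq {r d k : ℝ → ℝ} {s : ℝ} (h : r s = 0) :
    parallelCurv r d k s = k s := if_pos h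

/-- The function `g` expresses the Weingarten relation as `(κ₁ + κ₂) / 2 = g ((κ₁ - κ₂) / 2)`. -/
structure IsEllipticRelation (g : ℝ → ℝ) : Prop where
  contDiff : ContDiff ℝ 2 g
  deriv_sq_lt : ∀ u, deriv g u ^ 2 < 1

theorem IsEllipticRelation.neg_comp_neg {g : ℝ → ℝ} (hg : IsEllipticRelation g) :
    IsEllipticRelation fun u => -g (-u) where
  contDiff := (hg.contDiff.comp contDiff_neg).neg
  deriv_sq_lt u := by
    have : deriv (fun u => -g (-u)) u = deriv g (-u) := by
      rw [deriv.fun_neg, deriv_comp_neg, neg_neg]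
    rw [this]; exact hg.deriv_sq_lt _

theorem IsEllipticRelation.hasDerivAt {g : ℝ → ℝ} (hg : IsEllipticRelation g) (u : ℝ) :
    HasDerivAt g (deriv g u) u :=
  (hg.contDiff.differentiable (by norm_num) u).hasDerivAt

/-- With u = (κ₁ - κ₂)/2 this function is κ₁, and the one in `strictAnti_sub` is κ₂; together they
make each principal curvature a decreasing function of the other. -/
theorem IsEllipticRelation.strictMono_add {g : ℝ → ℝ} (hg : IsEllipticRelation g) :
    StrictMono fun u => g u + u := by
  refine strictMono_of_deriv_pos fun u => ?_
  rw [((hg.hasDerivAt u).fun_add (hasDerivAt_id' u)).deriv]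
  nlinarith [hg.deriv_sq_lt u]

theorem IsEllipticRelation.strictAnti_sub {g : ℝ → ℝ} (hg : IsEllipticRelation g) :
    StrictAnti fun u => g u - u := by
  refine strictAnti_of_deriv_neg fun u => ?_
  rw [((hg.hasDerivAt u).fun_sub (hasDerivAt_id' u)).deriv]
  nlinarith [hg.deriv_sq_lt u]

/-- The derivative of φ(u²) is 2uφ'(u²), whose square is 4tφ'(t)² at t = u². Composing with the
square also removes the boundary point of the domain of `φ`. -/
theorem IsElliptic.isEllipticRelation {φ : ℝ → ℝ} (hφ : IsElliptic φ) :
    IsEllipticRelation fun u => φ (u ^ 2) where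
  contDiff := by
    have h : ContDiffOn ℝ ∞ (fun u : ℝ => φ (u ^ 2)) univ :=
      hφ.1.comp (contDiff_id.pow 2).contDiffOn fun u _ => sq_nonneg u
    exact (contDiffOn_univ.1 h).of_le (WithTop.coe_le_coe.2 le_top)
  deriv_sq_lt u := by
    have h1 : HasDerivWithinAt φ (derivWithin φ (Ici 0) (u ^ 2)) (Ici 0) (u ^ 2) :=
      (hφ.1.differentiableOn (by simp) (u ^ 2) (sq_nonneg u)).hasDerivWithinAt
    have h2 : HasDerivAt (fun u : ℝ => φ (u ^ 2)) (derivWithin φ (Ici 0) (u ^ 2) * (2 * u)) u := by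
      have h3 : HasDerivWithinAt (fun u : ℝ => u ^ 2) (2 * u) univ u := by
        simpa using (hasDerivAt_pow 2 u).hasDerivWithinAt (s := univ)
      exact (HasDerivWithinAt.comp (h := fun u : ℝ => u ^ 2) u h1 h3
        (fun v _ => sq_nonneg v)).hasDerivAt univ_mem
    rw [h2.deriv]
    have := hφ.2 (u ^ 2) (sq_nonneg u)
    nlinarith

theorem IsElliptic.isEllipticRelation_neg {φ : ℝ → ℝ} (hφ : IsElliptic φ) :
    IsEllipticRelation fun u => -φ (u ^ 2) := by
  simpa using hφ.isEllipticRelation.neg_comp_neg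

/-- The equation `(κ₁ + κ₂) / 2 = g ((κ₁ - κ₂) / 2)` at the parameter `s`. -/
def RelationAt (g : ℝ → ℝ) (r d k : ℝ → ℝ) (s : ℝ) : Prop :=
  (k s + parallelCurv r d k s) / 2 = g ((k s - parallelCurv r d k s) / 2)

/-! ### Calculus on an interval. -/

/-- Serves the arguments by contradiction below: if an inequality fails at `b`, it fails on the
whole interval after the last point where it holds. -/
theorem exists_last_nonpos {f : ℝ → ℝ} {a b : ℝ} (hab : a ≤ b) (hf : ContinuousOn f (Icc a b))
    (ha : f a ≤ 0) (hb : 0 < f b) :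
    ∃ x ∈ Ico a b, f x ≤ 0 ∧ ∀ y ∈ Ioc x b, 0 < f y := by
  have hc : IsCompact {x ∈ Icc a b | f x ≤ 0} :=
    isCompact_Icc.of_isClosed_subset
      (hf.preimage_isClosed_of_isClosed isClosed_Icc isClosed_Iic) fun x hx => hx.1
  obtain ⟨x, hx, hmax⟩ := hc.exists_isGreatest ⟨a, ⟨le_rfl, hab⟩, ha⟩
  have hxb : x < b := lt_of_le_of_ne hx.1.2 fun h => by
    have := hx.2
    rw [h] at this; linarith
  refine ⟨x, ⟨hx.1.1, hxb⟩, hx.2, fun y hy => ?_⟩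
  by_contra hn
  exact absurd (hmax ⟨⟨hx.1.1.trans hy.1.le, hy.2⟩, not_lt.1 hn⟩) (not_le.2 hy.1)

theorem sub_le_of_hasDerivAt_le {f f' : ℝ → ℝ} {x y C : ℝ} (hxy : x ≤ y)
    (hc : ContinuousOn f (Icc x y)) (hd : ∀ z ∈ Ioo x y, HasDerivAt f (f' z) z)
    (hb : ∀ z ∈ Ioo x y, f' z ≤ C) : f y - f x ≤ C * (y - x) := by
  refine (convex_Icc x y).image_sub_le_mul_sub_of_deriv_le hc ?_ ?_ x ⟨le_rfl, hxy⟩ y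
    ⟨hxy, le_rfl⟩ hxy
  · rw [interior_Icc]
    exact fun z hz => (hd z hz).differentiableAt.differentiableWithinAt
  · rw [interior_Icc]
    intro z hz
    rw [(hd z hz).deriv]; exact hb z hz

theorem le_sub_of_le_hasDerivAt {f f' : ℝ → ℝ} {x y C : ℝ} (hxy : x ≤ y)
    (hc : ContinuousOn f (Icc x y)) (hd : ∀ z ∈ Ioo x y, HasDerivAt f (f' z) z)
    (hb : ∀ z ∈ Ioo x y, C ≤ f' z) : C * (y - x) ≤ f y - f x := by
  have := sub_le_of_hasDerivAt_le (f := fun z => -f z) (f' := fun z => -f' z) (C := -C) hxy hc.neg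
    (fun z hz => (hd z hz).neg) (fun z hz => neg_le_neg (hb z hz))
  linarith

theorem cosh_le_sinh_add_div {x : ℝ} (hx : 0 < x) :
    Real.cosh x / Real.sinh x ≤ 1 + 1 / x := by
  have h1 : x ≤ Real.sinh x := Real.self_le_sinh_iff.2 hx.le
  have h2 : Real.cosh x - Real.sinh x ≤ 1 := by
    rw [Real.cosh_sub_sinh]; exact Real.exp_le_one_iff.2 (by linarith)
  have h3 : 0 < Real.sinh x := hx.trans_le h1
  have h4 : 1 / Real.sinh x ≤ 1 / x := one_div_le_one_div_of_le hx h1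
  calc Real.cosh x / Real.sinh x ≤ (Real.sinh x + 1) / Real.sinh x := by gcongr; linarith
    _ = 1 + 1 / Real.sinh x := by field_simp
    _ ≤ 1 + 1 / x := by linarith

theorem hasDerivAt_comp_neg_of {f : ℝ → ℝ} {f' s : ℝ} (h : HasDerivAt f f' (-s)) :
    HasDerivAt (fun x => f (-x)) (-f') s := by
  exact (h.comp s (hasDerivAt_neg s)).congr_deriv (by ring)

/-! ### Symmetries of profiles and the curvature of the parallels. -/

namespace IsProfile

variable {I : Set ℝ} {r c d k : ℝ → ℝ}

theorem mono {J : Set ℝ} (P : IsProfile I r c d k) (h : J ⊆ I) : IsProfile J r c d k :=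
  ⟨fun s hs => P.1 s (h hs), fun s hs => P.2 s (h hs), fun s hs => P.3 s (h hs),
    fun s hs => P.4 s (h hs), fun s hs => P.5 s (h hs)⟩

/-- Reflection in a horizontal plane, reflection in the axis and reversal of the parameter each
change the sign of both curvatures, which replaces g(u) by -g(-u). -/
theorem flip_height (P : IsProfile I r c d k) :
    IsProfile I r c (fun s => -d s) (fun s => -k s) where
  hasDerivAt_r := P.1
  hasDerivAt_c s hs := by simpa using P.2 s hs
  hasDerivAt_d s hs := by simpa using (P.3 s hs).fun_neg
  differentiableAt_k s hs := (P.4 s hs).neg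
  unit s hs := by simpa using P.5 s hs

theorem flip_radius (P : IsProfile I r c d k) :
    IsProfile I (fun s => -r s) (fun s => -c s) d (fun s => -k s) where
  hasDerivAt_r s hs := (P.1 s hs).fun_neg
  hasDerivAt_c s hs := by simpa using (P.2 s hs).fun_neg
  hasDerivAt_d s hs := by simpa using P.3 s hs
  differentiableAt_k s hs := (P.4 s hs).neg
  unit s hs := by simpa using P.5 s hs

theorem reverse (P : IsProfile I r c d k) :
    IsProfile {s | -s ∈ I} (fun s => r (-s)) (fun s => -c (-s)) (fun s => -d (-s))
      (fun s => -k (-s)) where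
  hasDerivAt_r s hs := hasDerivAt_comp_neg_of (P.1 (-s) hs)
  hasDerivAt_c s hs := by simpa using (hasDerivAt_comp_neg_of (P.2 (-s) hs)).fun_neg
  hasDerivAt_d s hs := by simpa using (hasDerivAt_comp_neg_of (P.3 (-s) hs)).fun_neg
  differentiableAt_k s hs :=
    (DifferentiableAt.comp s (P.4 (-s) hs) differentiableAt_id.neg).neg
  unit s hs := by simpa using P.5 (-s) hs

theorem parallelCurv_flip_height (s : ℝ) :
    parallelCurv r (fun s => -d s) (fun s => -k s) s = -parallelCurv r d k s := by
  unfold parallelCurv; split_ifs <;> ring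

theorem parallelCurv_flip_radius (s : ℝ) :
    parallelCurv (fun s => -r s) d (fun s => -k s) s = -parallelCurv r d k s := by
  unfold parallelCurv
  simp only [neg_eq_zero, Real.cosh_neg, Real.sinh_neg]
  split_ifs
  · rfl
  · rw [div_neg]

theorem parallelCurv_reverse (s : ℝ) :
    parallelCurv (fun s => r (-s)) (fun s => -d (-s)) (fun s => -k (-s)) s =
      -parallelCurv r d k (-s) := by
  unfold parallelCurv; split_ifs <;> ring

/-- The Codazzi equation. Where r and r' are positive, the sign of the derivative is that of k -
K/cosh² r. -/
theorem hasDerivAt_parallelCurv (P : IsProfile I r c d k) {s : ℝ} (hs : s ∈ I) (hr : r s ≠ 0) :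
    HasDerivAt (parallelCurv r d k) (c s * (Real.cosh (r s) / Real.sinh (r s)) *
      (k s - parallelCurv r d k s / Real.cosh (r s) ^ 2)) s := by
  have hsh : Real.sinh (r s) ≠ 0 := by simpa using hr
  have hch : Real.cosh (r s) ≠ 0 := (Real.cosh_pos _).ne'
  have h1 := ((P.3 s hs).mul (P.1 s hs).cosh).div (P.1 s hs).sinh hsh
  have h2 : parallelCurv r d k =ᶠ[𝓝 s] fun s => d s * Real.cosh (r s) / Real.sinh (r s) := by
    filter_upwards [(P.1 s hs).continuousAt.eventually_ne hr] with x hx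
    exact parallelCurv_of_ne hx
  refine (h1.congr_of_eventuallyEq h2).congr_deriv ?_
  rw [parallelCurv_of_ne hr]
  simp only [Pi.mul_apply]
  have := Real.cosh_sq (r s)
  field_simp
  rw [this]; ring

/-- As `d` and sinh r both vanish at `a`, their quotient tends to the quotient of their derivatives,
kc/c = k; this justifies the value given to `parallelCurv` on the axis. -/
theorem continuousAt_parallelCurv_of_eq_zero (P : IsProfile I r c d k) {a : ℝ} (ha : a ∈ I)
    (hr : r a = 0) (hd : d a = 0) : ContinuousAt (parallelCurv r d k) a := by
  have hc : c a ≠ 0 := by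
    intro h
    have := P.5 a ha
    rw [h, hd] at this; norm_num at this
  rw [continuousAt_iff_punctured_nhds, parallelCurv_of_eq hr]
  have h1 := (P.3 a ha).tendsto_slope
  have h2 := (P.1 a ha).sinh.tendsto_slope
  have h3 : Tendsto (fun s => Real.cosh (r s)) (𝓝[≠] a) (𝓝 1) := by
    have : ContinuousAt (fun s => Real.cosh (r s)) a := (P.1 a ha).cosh.continuousAt
    simpa [ContinuousAt, hr] using this.tendsto.mono_left nhdsWithin_le_nhds
  have h4 := (h1.mul h3).div h2 (by simpa [hr] using hc)
  have h5 : k a * c a * 1 / (Real.cosh (r a) * c a) = k a := by rw [hr]; simp [hc]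
  rw [h5] at h4
  refine h4.congr' ?_
  have h6 : ∀ᶠ s in 𝓝[≠] a, r s ≠ r a := (P.1 a ha).eventually_ne hc
  filter_upwards [h6, self_mem_nhdsWithin] with s hs hsa
  rw [hr] at hs
  have : s - a ≠ 0 := sub_ne_zero.2 hsa
  have hsh : Real.sinh (r s) ≠ 0 := by simpa using hs
  simp only [Pi.div_apply, slope_def_field, hd, hr, Real.sinh_zero, sub_zero, parallelCurv_of_ne hs]
  field_simp

theorem continuousAt_parallelCurv (P : IsProfile I r c d k) {a : ℝ} (ha : a ∈ I)
    (hd : r a = 0 → d a = 0) : ContinuousAt (parallelCurv r d k) a := by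
  by_cases hr : r a = 0
  · exact P.continuousAt_parallelCurv_of_eq_zero ha hr (hd hr)
  · exact (P.hasDerivAt_parallelCurv ha hr).continuousAt

end IsProfile

theorem RelationAt.curv_eq {g r d k : ℝ → ℝ} {s : ℝ} (h : RelationAt g r d k s) :
    k s = g ((k s - parallelCurv r d k s) / 2) + (k s - parallelCurv r d k s) / 2 := by
  rw [← h]; ring

theorem RelationAt.parallelCurv_eq {g r d k : ℝ → ℝ} {s : ℝ} (h : RelationAt g r d k s) :
    parallelCurv r d k s =
      g ((k s - parallelCurv r d k s) / 2) - (k s - parallelCurv r d k s) / 2 := by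
  rw [← h]; ring

/-! ### Curvature estimates on an arc leaving the axis. -/

namespace IsProfile

variable {I : Set ℝ} {r c d k g : ℝ → ℝ} {a e b : ℝ}

theorem continuousOn_parallelCurv_Ico (P : IsProfile (Ico a e) r c d k)
    (hda : d a = 0) (hr : ∀ s ∈ Ioo a e, 0 < r s) :
    ContinuousOn (parallelCurv r d k) (Ico a e) := fun s hs =>
  (P.continuousAt_parallelCurv hs fun h => by
    rcases eq_or_lt_of_le hs.1 with h1 | h1
    · rw [← h1]; exact hda
    · exact absurd h (hr s ⟨h1, hs.2⟩).ne').continuousWithinAt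

/-- The relation is assumed only off the axis. In the limit at the pole the two curvatures coincide,
so that u → 0. -/
theorem curv_eq_of_pole (hg : ContinuousAt g 0) (P : IsProfile (Ico a e) r c d k) (hae : a < e)
    (hra : r a = 0) (hda : d a = 0) (hW : ∀ s ∈ Ioo a e, RelationAt g r d k s) : k a = g 0 := by
  have ha : a ∈ Ico a e := ⟨le_rfl, hae⟩
  have h1 : ContinuousAt (parallelCurv r d k) a :=
    P.continuousAt_parallelCurv ha fun _ => hda
  have h2 : ContinuousAt k a := (P.4 a ha).continuousAt
  have h3 : parallelCurv r d k a = k a := parallelCurv_of_eq hra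
  have h4 : Tendsto (fun s => (k s + parallelCurv r d k s) / 2) (𝓝[>] a) (𝓝 (k a)) := by
    have : ContinuousAt (fun s => (k s + parallelCurv r d k s) / 2) a := (h2.add h1).div_const 2
    have := this.tendsto.mono_left (nhdsWithin_le_nhds (s := Ioi a))
    rwa [h3, add_self_div_two] at this
  have h5 : Tendsto (fun s => g ((k s - parallelCurv r d k s) / 2)) (𝓝[>] a) (𝓝 (g 0)) := by
    have h6 : ContinuousAt (fun s => (k s - parallelCurv r d k s) / 2) a := (h2.sub h1).div_const 2
    have h7 := h6.tendsto
    rw [h3, sub_self, zero_div] at h7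
    exact hg.tendsto.comp (h7.mono_left nhdsWithin_le_nhds)
  refine tendsto_nhds_unique h4 (h5.congr' ?_)
  filter_upwards [Ioo_mem_nhdsGT hae] with s hs
  exact (hW s hs).symm

/-- On an arc that starts at the axis and moves away from it, the meridian curvature is at most the
curvature at the pole, and the other one is at least that curvature. -/
theorem ascending_umbilic_le (hg : IsEllipticRelation g) (hg0 : 0 ≤ g 0)
    (P : IsProfile (Ico a e) r c d k) (hra : r a = 0) (hda : d a = 0)
    (hr : ∀ s ∈ Ioo a e, 0 < r s) (hc : ∀ s ∈ Ioo a e, 0 < c s)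
    (hW : ∀ s ∈ Ioo a e, RelationAt g r d k s) {s : ℝ} (hs : s ∈ Ioo a e) :
    k s ≤ parallelCurv r d k s := by
  set K := parallelCurv r d k with hK
  have hKc : ContinuousOn K (Ico a e) := P.continuousOn_parallelCurv_Ico hda hr
  have hkc : ContinuousOn k (Ico a e) := fun x hx => (P.4 x hx).continuousAt.continuousWithinAt
  have hka : k a = g 0 := curv_eq_of_pole hg.contDiff.continuous.continuousAt P (hs.1.trans hs.2)
    hra hda hW
  have hKa : K a = g 0 := by rw [hK, parallelCurv_of_eq hra, hka]
  have hsub : Icc a s ⊆ Ico a e := fun x hx => ⟨hx.1, hx.2.trans_lt hs.2⟩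
  by_contra hn
  -- After the last point x with k ≤ K one has u > 0, so K < g(0) < k and the Codazzi equation makes
  -- K nondecreasing. But K(x) ≥ g(0), which contradicts K(s) < g(0).
  obtain ⟨x, hx, hx0, hpos⟩ := exists_last_nonpos (f := fun s => k s - K s) hs.1.le
    ((hkc.sub hKc).mono hsub) (by simp [hka, hKa]) (by linarith [not_le.1 hn])
  have hlow : ∀ y ∈ Ioc x s, K y < g 0 ∧ g 0 < k y := fun y hy => by
    have h1 := hpos y hy
    have h2 := hW y ⟨hx.1.trans_lt hy.1, hy.2.trans_lt hs.2⟩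
    have h3 : 0 < (k y - K y) / 2 := by linarith
    have h4 := hg.strictMono_add h3
    have h5 := hg.strictAnti_sub h3
    simp only at h4 h5
    rw [h2.curv_eq.symm] at h4
    rw [h2.parallelCurv_eq.symm] at h5
    constructor <;> linarith
  have hKx : g 0 ≤ K x := by
    rcases eq_or_lt_of_le hx.1 with h1 | h1
    · rw [← h1, hKa]
    · have h2 := hW x ⟨h1, hx.2.trans hs.2⟩
      have h3 : (k x - K x) / 2 ≤ 0 := by linarith
      have h5 := hg.strictAnti_sub.antitone h3
      rw [h2.parallelCurv_eq.symm] at h5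
      linarith
  have := le_sub_of_le_hasDerivAt (f := K) (C := 0) hx.2.le
    (hKc.mono fun y hy => ⟨hx.1.trans hy.1, hy.2.trans_lt hs.2⟩)
    (fun z hz => P.hasDerivAt_parallelCurv ⟨hx.1.trans hz.1.le, hz.2.trans hs.2⟩
      (hr z ⟨hx.1.trans_lt hz.1, hz.2.trans hs.2⟩).ne')
    (fun z hz => by
      have hz' : z ∈ Ioo a e := ⟨hx.1.trans_lt hz.1, hz.2.trans hs.2⟩
      obtain ⟨h1, h2⟩ := hlow z ⟨hz.1, hz.2.le⟩
      have h3 : (1 : ℝ) ≤ Real.cosh (r z) ^ 2 := one_le_pow₀ (Real.one_le_cosh _)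
      have h4 : K z / Real.cosh (r z) ^ 2 ≤ k z := by
        rw [div_le_iff₀ (by linarith)]
        nlinarith
      have h5 : 0 < Real.sinh (r z) := Real.sinh_pos_iff.2 (hr z hz')
      have h6 := Real.cosh_pos (r z)
      have h7 := hc z hz'
      exact mul_nonneg (by positivity) (by linarith))
  have h8 := (hlow s ⟨hx.2, le_rfl⟩).1
  linarith

/-- On an arc that starts at the axis and moves away from it, the curvature of the parallels is
nondecreasing. -/
theorem ascending_div_cosh_sq_le (hg : IsEllipticRelation g) (hg0 : 0 ≤ g 0)
    (P : IsProfile (Ico a e) r c d k) (hra : r a = 0) (hda : d a = 0)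
    (hr : ∀ s ∈ Ioo a e, 0 < r s) (hc : ∀ s ∈ Ioo a e, 0 < c s)
    (hW : ∀ s ∈ Ioo a e, RelationAt g r d k s) {s : ℝ} (hs : s ∈ Ioo a e) :
    parallelCurv r d k s / Real.cosh (r s) ^ 2 ≤ k s := by
  set K := parallelCurv r d k with hK
  have hKc : ContinuousOn K (Ico a e) := P.continuousOn_parallelCurv_Ico hda hr
  have hkc : ContinuousOn k (Ico a e) := fun x hx => (P.4 x hx).continuousAt.continuousWithinAt
  have hrc : ContinuousOn r (Ico a e) := fun x hx => (P.1 x hx).continuousAt.continuousWithinAt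
  have hka : k a = g 0 := curv_eq_of_pole hg.contDiff.continuous.continuousAt P (hs.1.trans hs.2)
    hra hda hW
  have hKa : K a = g 0 := by rw [hK, parallelCurv_of_eq hra, hka]
  have hsub : Icc a s ⊆ Ico a e := fun x hx => ⟨hx.1, hx.2.trans_lt hs.2⟩
  have hu : ∀ y ∈ Ico a e, (k y - K y) / 2 ≤ 0 ∧ k y = g ((k y - K y) / 2) + (k y - K y) / 2 ∧
      K y = g ((k y - K y) / 2) - (k y - K y) / 2 := fun y hy => by
    rcases eq_or_lt_of_le hy.1 with h1 | h1
    · simp [← h1, hka, hKa]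
    · have h2 := hW y ⟨h1, hy.2⟩
      refine ⟨?_, h2.curv_eq, h2.parallelCurv_eq⟩
      have := P.ascending_umbilic_le hg hg0 hra hda hr hc hW ⟨h1, hy.2⟩
      rw [← hK] at this; linarith
  have hanti : ∀ x ∈ Ico a e, ∀ y ∈ Ico a e, K y ≤ K x → k x ≤ k y := fun x hx y hy h => by
    obtain ⟨-, hx1, hx2⟩ := hu x hx
    obtain ⟨-, hy1, hy2⟩ := hu y hy
    rw [hx2, hy2] at h
    have h1 := hg.strictAnti_sub.le_iff_ge.1 h
    rw [hx1, hy1]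
    exact hg.strictMono_add.monotone h1
  have hcoshc : ContinuousOn (fun s => Real.cosh (r s) ^ 2) (Ico a e) :=
    (Real.continuous_cosh.comp_continuousOn hrc).pow 2
  have hcosh : ∀ y, (0 : ℝ) < Real.cosh (r y) ^ 2 := fun y => pow_pos (Real.cosh_pos _) 2
  by_contra hn
  -- After the last point x where the inequality holds, the Codazzi equation makes K nonincreasing.
  -- Then `k` has not decreased from x to s, by `hanti`, while cosh r has not decreased either, so
  -- the inequality at x passes to s.
  obtain ⟨x, hx, hx0, hpos⟩ := exists_last_nonpos
    (f := fun s => K s / Real.cosh (r s) ^ 2 - k s) hs.1.le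
    (((hKc.div hcoshc fun y _ => (hcosh y).ne').sub hkc).mono hsub) (by simp [hka, hKa, hra])
    (by linarith [not_le.1 hn])
  have hxs : Icc x s ⊆ Ico a e := fun y hy => ⟨hx.1.trans hy.1, hy.2.trans_lt hs.2⟩
  have hxs' : Ioo x s ⊆ Ioo a e := fun y hy => ⟨hx.1.trans_lt hy.1, hy.2.trans hs.2⟩
  have hKs : K s ≤ K x := by
    have := sub_le_of_hasDerivAt_le (f := K) (C := 0) hx.2.le (hKc.mono hxs)
      (fun z hz => P.hasDerivAt_parallelCurv (hxs ⟨hz.1.le, hz.2.le⟩) (hr z (hxs' hz)).ne')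
      (fun z hz => by
        have h2 := hpos z ⟨hz.1, hz.2.le⟩
        have h5 : 0 < Real.sinh (r z) := Real.sinh_pos_iff.2 (hr z (hxs' hz))
        have h6 := Real.cosh_pos (r z)
        have h7 := hc z (hxs' hz)
        exact mul_nonpos_of_nonneg_of_nonpos (by positivity) (by linarith))
    linarith
  have hrs : r x ≤ r s := by
    have := le_sub_of_le_hasDerivAt (f := r) (C := 0) hx.2.le (hrc.mono hxs)
      (fun z hz => P.1 z (hxs ⟨hz.1.le, hz.2.le⟩)) (fun z hz => (hc z (hxs' hz)).le)
    linarith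
  have hrx : 0 ≤ r x := by
    rcases eq_or_lt_of_le hx.1 with h1 | h1
    · rw [← h1, hra]
    · exact (hr x ⟨h1, hx.2.trans hs.2⟩).le
  have h1 := hanti x (hxs ⟨le_rfl, hx.2.le⟩) s (hxs ⟨hx.2.le, le_rfl⟩) hKs
  have hK0 : 0 ≤ K s := by
    obtain ⟨h2, -, h3⟩ := hu s (hxs ⟨hx.2.le, le_rfl⟩)
    have h4 := hg.strictAnti_sub.antitone h2
    rw [h3]; linarith
  have h5 : K s / Real.cosh (r s) ^ 2 ≤ K x / Real.cosh (r x) ^ 2 := by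
    have : Real.cosh (r x) ≤ Real.cosh (r s) := by
      rw [Real.cosh_le_cosh, abs_of_nonneg hrx, abs_of_nonneg (hrx.trans hrs)]
      exact hrs
    have h6 : Real.cosh (r x) ^ 2 ≤ Real.cosh (r s) ^ 2 :=
      pow_le_pow_left₀ (Real.cosh_pos _).le this 2
    exact div_le_div₀ (hK0.trans hKs) hKs (hcosh x) h6
  have h7 := hpos s ⟨hx.2, le_rfl⟩
  linarith

/-- Curvature bounds on an arc that starts at the axis and moves away from it. -/
theorem ascending_bounds (hg : IsEllipticRelation g) (hg0 : 0 ≤ g 0)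
    (P : IsProfile (Ico a e) r c d k) (hra : r a = 0) (hda : d a = 0)
    (hr : ∀ s ∈ Ioo a e, 0 < r s) (hc : ∀ s ∈ Ioo a e, 0 < c s)
    (hW : ∀ s ∈ Ioo a e, RelationAt g r d k s) {s : ℝ} (hs : s ∈ Ioo a e) :
    0 ≤ k s ∧ k s ≤ g 0 ∧ 0 ≤ parallelCurv r d k s ∧ parallelCurv r d k s ≤ 1 + 4 * g 0 := by
  have hrc : ContinuousOn r (Ico a e) := fun x hx => (P.1 x hx).continuousAt.continuousWithinAt
  have hcc : ContinuousOn c (Ico a e) := fun x hx => (P.2 x hx).continuousAt.continuousWithinAt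
  have hdc : ContinuousOn d (Ico a e) := fun x hx => (P.3 x hx).continuousAt.continuousWithinAt
  have hk : ∀ y ∈ Ioo a e, 0 ≤ k y ∧ k y ≤ g 0 ∧ 0 ≤ parallelCurv r d k y := fun y hy => by
    have h1 := P.ascending_umbilic_le hg hg0 hra hda hr hc hW hy
    have h2 := P.ascending_div_cosh_sq_le hg hg0 hra hda hr hc hW hy
    have h3 : (k y - parallelCurv r d k y) / 2 ≤ 0 := by linarith
    have h4 := hg.strictMono_add.monotone h3
    have h5 := hg.strictAnti_sub.antitone h3
    rw [(hW y hy).curv_eq.symm] at h4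
    rw [(hW y hy).parallelCurv_eq.symm] at h5
    have h6 : 0 ≤ parallelCurv r d k y := by linarith
    exact ⟨(div_nonneg h6 (sq_nonneg _)).trans h2, by linarith, h6⟩
  have hd0 : ∀ y ∈ Ioo a e, 0 ≤ d y := fun y hy => by
    have h1 := (hk y hy).2.2
    have h2 : 0 < Real.sinh (r y) := Real.sinh_pos_iff.2 (hr y hy)
    rw [parallelCurv_of_ne (hr y hy).ne', le_div_iff₀ h2, zero_mul] at h1
    exact nonneg_of_mul_nonneg_left h1 (Real.cosh_pos _)
  have hle1 : ∀ y ∈ Ioo a e, c y ≤ 1 ∧ d y ≤ 1 := fun y hy => by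
    have := P.5 y ⟨hy.1.le, hy.2⟩
    constructor <;> nlinarith
  have hca : 1 ≤ c a := by
    have h1 := P.5 a ⟨le_rfl, hs.1.trans hs.2⟩
    have h2 : 0 ≤ c a := by
      have h3 : Tendsto c (𝓝[>] a) (𝓝 (c a)) :=
        (P.2 a ⟨le_rfl, hs.1.trans hs.2⟩).continuousAt.tendsto.mono_left nhdsWithin_le_nhds
      refine ge_of_tendsto h3 ?_
      filter_upwards [Ioo_mem_nhdsGT (hs.1.trans hs.2)] with y hy using (hc y hy).le
    rw [hda] at h1
    nlinarith
  -- Since 0 ≤ k ≤ g(0), the tangent turns at speed at most g(0), starting from d = 0 and c = 1.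
  have hdle : ∀ y ∈ Ioo a e, d y ≤ g 0 * (y - a) := fun y hy => by
    have := sub_le_of_hasDerivAt_le (f := d) (C := g 0) hy.1.le
      (hdc.mono fun z hz => ⟨hz.1, hz.2.trans_lt hy.2⟩)
      (fun z hz => P.3 z ⟨hz.1.le, hz.2.trans hy.2⟩) (fun z hz => by
        have hz' : z ∈ Ioo a e := ⟨hz.1, hz.2.trans hy.2⟩
        obtain ⟨h1, h2, -⟩ := hk z hz'
        have h3 := hc z hz'
        have h4 := (hle1 z hz').1
        nlinarith)
    rw [hda] at this; linarith
  have hcge : ∀ y ∈ Ioo a e, 1 - g 0 * (y - a) ≤ c y := fun y hy => by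
    have := le_sub_of_le_hasDerivAt (f := c) (C := -g 0) hy.1.le
      (hcc.mono fun z hz => ⟨hz.1, hz.2.trans_lt hy.2⟩)
      (fun z hz => P.2 z ⟨hz.1.le, hz.2.trans hy.2⟩) (fun z hz => by
        have hz' : z ∈ Ioo a e := ⟨hz.1, hz.2.trans hy.2⟩
        obtain ⟨h1, h2, -⟩ := hk z hz'
        have h3 := hd0 z hz'
        have h4 := (hle1 z hz').2
        nlinarith)
    linarith
  have hrge : ∀ y ∈ Ioo a e, 2 * g 0 * (y - a) ≤ 1 → (y - a) / 2 ≤ r y := fun y hy h => by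
    have := le_sub_of_le_hasDerivAt (f := r) (C := 1 / 2) hy.1.le
      (hrc.mono fun z hz => ⟨hz.1, hz.2.trans_lt hy.2⟩)
      (fun z hz => P.1 z ⟨hz.1.le, hz.2.trans hy.2⟩) (fun z hz => by
        have hz' : z ∈ Ioo a e := ⟨hz.1, hz.2.trans hy.2⟩
        have h1 := hcge z hz'
        have h2 : g 0 * (z - a) ≤ g 0 * (y - a) :=
          mul_le_mul_of_nonneg_left (by linarith [hz.2]) hg0
        linarith)
    rw [hra] at this; linarith
  -- Up to parameter distance 1/(2g(0)) from the pole, c ≥ 1/2, so r ≥ (s - a)/2 and d ≤ 2g(0)r.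
  -- Beyond it d ≤ 1, while r is still at least 1/(4g(0)); this second case fixes the constant 4.
  have hdr : d s ≤ 4 * g 0 * r s := by
    by_cases h : 2 * g 0 * (s - a) ≤ 1
    · have h1 := hrge s hs h
      have h2 := hdle s hs
      have h3 := mul_le_mul_of_nonneg_left h1 hg0
      have h4 : 0 ≤ g 0 * r s := mul_nonneg hg0 (hr s hs).le
      linarith
    · rw [not_le] at h
      have hgp : 0 < g 0 := lt_of_le_of_ne hg0 fun h0 => by
        rw [← h0] at h; norm_num at h
      set x := a + 1 / (2 * g 0) with hx
      have hxa : x - a = 1 / (2 * g 0) := by rw [hx]; ring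
      have hx1 : 0 < x - a := by rw [hxa]; positivity
      have hx2 : 2 * g 0 * (x - a) = 1 := by rw [hxa]; field_simp
      have hxs : x < s := by
        by_contra hn
        have : 2 * g 0 * (s - a) ≤ 2 * g 0 * (x - a) :=
          mul_le_mul_of_nonneg_left (by linarith) (by linarith)
        linarith
      have h1 := hrge x ⟨by linarith, hxs.trans hs.2⟩ hx2.le
      have h2 := le_sub_of_le_hasDerivAt (f := r) (C := 0) hxs.le
        (hrc.mono fun z hz => ⟨by linarith [hz.1], hz.2.trans_lt hs.2⟩)
        (fun z hz => P.1 z ⟨by linarith [hz.1], hz.2.trans hs.2⟩)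
        (fun z hz => (hc z ⟨by linarith [hz.1], hz.2.trans hs.2⟩).le)
      have h3 := mul_le_mul_of_nonneg_left (show (x - a) / 2 ≤ r s by linarith) hg0
      have h4 := (hle1 s hs).2
      linarith
  obtain ⟨h1, h2, h3⟩ := hk s hs
  refine ⟨h1, h2, h3, ?_⟩
  rw [parallelCurv_of_ne (hr s hs).ne', mul_div_assoc]
  have h4 := mul_le_mul_of_nonneg_left (cosh_le_sinh_add_div (hr s hs)) (hd0 s hs)
  have h5 : d s * (1 / r s) ≤ 4 * g 0 := by
    rw [mul_one_div, div_le_iff₀ (hr s hs)]; exact hdr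
  have h6 := (hle1 s hs).2
  linarith

/-! ### The profile ODE and its reflection symmetry. -/

/-- The vector field satisfied by `(r, c, d, (κ₁ - κ₂) / 2)` along a Weingarten profile. -/
def weingartenField (g : ℝ → ℝ) (x : ℝ × ℝ × ℝ × ℝ) : ℝ × ℝ × ℝ × ℝ :=
  (x.2.1, -((g x.2.2.2 + x.2.2.2) * x.2.2.1), (g x.2.2.2 + x.2.2.2) * x.2.1,
    x.2.1 * (Real.cosh x.1 / Real.sinh x.1) * (g x.2.2.2 + x.2.2.2 -
      (g x.2.2.2 - x.2.2.2) / Real.cosh x.1 ^ 2) / (deriv g x.2.2.2 - 1))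

/-- Differentiating K = g(u) - u gives K' = (g'(u) - 1)u'; ellipticity is what allows solving for
u'. -/
theorem deriv_sub_one_ne_zero (hg : IsEllipticRelation g) (u : ℝ) : deriv g u - 1 ≠ 0 := by
  have := hg.deriv_sq_lt u
  intro h
  rw [sub_eq_zero.1 h] at this; norm_num at this

theorem contDiffOn_weingartenField (hg : IsEllipticRelation g) :
    ContDiffOn ℝ 1 (weingartenField g) {x | 0 < x.1} := by
  have hg1 : ContDiff ℝ 1 g := hg.contDiff.of_le (by norm_num)
  have hg2 : ContDiff ℝ 1 (deriv g) := (contDiff_succ_iff_deriv.1 hg.contDiff).2.2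
  have p1 : ContDiff ℝ 1 fun x : ℝ × ℝ × ℝ × ℝ => x.1 := contDiff_fst
  have p2 : ContDiff ℝ 1 fun x : ℝ × ℝ × ℝ × ℝ => x.2.1 := contDiff_fst.comp contDiff_snd
  have p3 : ContDiff ℝ 1 fun x : ℝ × ℝ × ℝ × ℝ => x.2.2.1 :=
    contDiff_fst.comp (contDiff_snd.comp contDiff_snd)
  have p4 : ContDiff ℝ 1 fun x : ℝ × ℝ × ℝ × ℝ => x.2.2.2 :=
    contDiff_snd.comp (contDiff_snd.comp contDiff_snd)
  have q1 : ContDiff ℝ 1 fun x : ℝ × ℝ × ℝ × ℝ => g x.2.2.2 + x.2.2.2 := (hg1.comp p4).add p4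
  have q2 : ContDiff ℝ 1 fun x : ℝ × ℝ × ℝ × ℝ => g x.2.2.2 - x.2.2.2 := (hg1.comp p4).sub p4
  have q3 : ContDiff ℝ 1 fun x : ℝ × ℝ × ℝ × ℝ => Real.cosh x.1 := Real.contDiff_cosh.comp p1
  have q4 : ContDiff ℝ 1 fun x : ℝ × ℝ × ℝ × ℝ => Real.sinh x.1 := Real.contDiff_sinh.comp p1
  have q5 : ContDiff ℝ 1 fun x : ℝ × ℝ × ℝ × ℝ => deriv g x.2.2.2 - 1 :=
    (hg2.comp p4).sub contDiff_const
  refine p2.contDiffOn.prodMk ((q1.mul p3).neg.contDiffOn.prodMk ((q1.mul p2).contDiffOn.prodMk ?_))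
  refine ContDiffOn.div (ContDiffOn.mul (ContDiffOn.mul p2.contDiffOn
    (q3.contDiffOn.div q4.contDiffOn fun x hx => ?_)) (q1.contDiffOn.sub
      (q2.contDiffOn.div (q3.pow 2).contDiffOn fun x _ => ?_))) q5.contDiffOn
      fun x _ => deriv_sub_one_ne_zero hg _
  · exact (Real.sinh_pos_iff.2 hx).ne'
  · exact (pow_pos (Real.cosh_pos _) 2).ne'

theorem hasDerivAt_weingartenField (hg : IsEllipticRelation g) (P : IsProfile I r c d k)
    {s : ℝ} (hs : s ∈ I) (hr : r s ≠ 0) (hW : ∀ᶠ x in 𝓝 s, RelationAt g r d k x) :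
    HasDerivAt (fun s => (r s, c s, d s, (k s - parallelCurv r d k s) / 2))
      (weingartenField g (r s, c s, d s, (k s - parallelCurv r d k s) / 2)) s := by
  have h0 := P.hasDerivAt_parallelCurv hs hr
  set K := parallelCurv r d k
  have hu : DifferentiableAt ℝ (fun s => (k s - K s) / 2) s :=
    ((P.4 s hs).sub h0.differentiableAt).div_const 2
  obtain ⟨u', hu'⟩ : ∃ u', HasDerivAt (fun s => (k s - K s) / 2) u' s := ⟨_, hu.hasDerivAt⟩
  have h1 : HasDerivAt (fun s => g ((k s - K s) / 2) - (k s - K s) / 2)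
      (deriv g ((k s - K s) / 2) * u' - u') s :=
    ((hg.hasDerivAt _).comp s hu').sub hu'
  have h2 : K =ᶠ[𝓝 s] fun s => g ((k s - K s) / 2) - (k s - K s) / 2 := by
    filter_upwards [hW] with x hx using hx.parallelCurv_eq
  have h3 := h0.unique (h1.congr_of_eventuallyEq h2)
  have h4 := hW.self_of_nhds.curv_eq
  have h5 := hW.self_of_nhds.parallelCurv_eq
  have h6 := deriv_sub_one_ne_zero hg ((k s - K s) / 2)
  refine (P.1 s hs).prodMk (HasDerivAt.prodMk ?_ (HasDerivAt.prodMk ?_ ?_))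
  · refine (P.2 s hs).congr_deriv ?_
    simp only; rw [← h4]
  · refine (P.3 s hs).congr_deriv ?_
    simp only; rw [← h4]
  · refine hu'.congr_deriv ?_
    simp only
    rw [eq_div_iff h6, ← h4, ← h5, h3]
    ring

end IsProfile

namespace IsProfile

variable {I : Set ℝ} {r c d k g : ℝ → ℝ} {a b : ℝ}

/-- A Weingarten profile is symmetric about the points with vertical tangent. -/
theorem symm_of_vertical (hg : IsEllipticRelation g) (P : IsProfile (Ioo a b) r c d k)
    (hr : ∀ s ∈ Ioo a b, 0 < r s) (hW : ∀ s ∈ Ioo a b, RelationAt g r d k s)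
    {s₁ σ : ℝ} (hσ : 0 ≤ σ) (hl : a < s₁ - σ) (hu : s₁ + σ < b) (hc : c s₁ = 0) :
    r (s₁ + σ) = r (s₁ - σ) ∧ d (s₁ + σ) = d (s₁ - σ) ∧ k (s₁ + σ) = k (s₁ - σ) ∧
      parallelCurv r d k (s₁ + σ) = parallelCurv r d k (s₁ - σ) := by
  set u : ℝ → ℝ := fun s => (k s - parallelCurv r d k s) / 2 with hudef
  have hder : ∀ s ∈ Ioo a b, HasDerivAt (fun s => (r s, c s, d s, u s))
      (weingartenField g (r s, c s, d s, u s)) s := fun s hs =>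
    hasDerivAt_weingartenField hg P hs (hr s hs).ne'
      (by filter_upwards [isOpen_Ioo.mem_nhds hs] with x hx using hW x hx)
  -- Reversing the parameter about `s₁` and changing the sign of `c` preserves the ODE. Both
  -- trajectories start from the same state because c(s₁) = 0.
  set f : ℝ → ℝ × ℝ × ℝ × ℝ := fun t => (r (s₁ + t), c (s₁ + t), d (s₁ + t), u (s₁ + t)) with hf
  set f' : ℝ → ℝ × ℝ × ℝ × ℝ := fun t => (r (s₁ - t), -c (s₁ - t), d (s₁ - t), u (s₁ - t)) with hf'
  have hm1 : ∀ t ∈ Icc 0 σ, s₁ + t ∈ Ioo a b := fun t ht =>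
    ⟨by linarith [ht.1], by linarith [ht.2]⟩
  have hm2 : ∀ t ∈ Icc 0 σ, s₁ - t ∈ Ioo a b := fun t ht =>
    ⟨by linarith [ht.2], by linarith [ht.1]⟩
  have hd1 : ∀ t ∈ Icc 0 σ, HasDerivAt f (weingartenField g (f t)) t := fun t ht =>
    (hder _ (hm1 t ht)).comp_const_add s₁ t
  have hd2 : ∀ t ∈ Icc 0 σ, HasDerivAt f' (weingartenField g (f' t)) t := fun t ht => by
    have h0 := (hder _ (hm2 t ht)).comp_const_sub s₁ t
    have e1 := (ContinuousLinearMap.fst ℝ ℝ (ℝ × ℝ × ℝ)).hasFDerivAt.comp_hasDerivAt t h0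
    have h1 := (ContinuousLinearMap.snd ℝ ℝ (ℝ × ℝ × ℝ)).hasFDerivAt.comp_hasDerivAt t h0
    have e2 := (ContinuousLinearMap.fst ℝ ℝ (ℝ × ℝ)).hasFDerivAt.comp_hasDerivAt t h1
    have h2 := (ContinuousLinearMap.snd ℝ ℝ (ℝ × ℝ)).hasFDerivAt.comp_hasDerivAt t h1
    have e3 := (ContinuousLinearMap.fst ℝ ℝ ℝ).hasFDerivAt.comp_hasDerivAt t h2
    have e4 := (ContinuousLinearMap.snd ℝ ℝ ℝ).hasFDerivAt.comp_hasDerivAt t h2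
    refine (e1.prodMk (e2.neg.prodMk (e3.prodMk e4))).congr_deriv ?_
    simp only [weingartenField, hf', ContinuousLinearMap.coe_fst', ContinuousLinearMap.coe_snd',
      Prod.fst_neg, Prod.snd_neg, Prod.mk.injEq]
    refine ⟨trivial, by ring, by ring, by ring⟩
  have hc1 : ContinuousOn f (Icc 0 σ) := fun t ht => (hd1 t ht).continuousAt.continuousWithinAt
  have hc2 : ContinuousOn f' (Icc 0 σ) := fun t ht => (hd2 t ht).continuousAt.continuousWithinAt
  have hcpt : IsCompact (f '' Icc 0 σ ∪ f' '' Icc 0 σ) :=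
    (isCompact_Icc.image_of_continuousOn hc1).union (isCompact_Icc.image_of_continuousOn hc2)
  have hne : (f '' Icc 0 σ ∪ f' '' Icc 0 σ).Nonempty :=
    ⟨f 0, Or.inl ⟨0, ⟨le_rfl, hσ⟩, rfl⟩⟩
  obtain ⟨x₀, hx₀, hmin⟩ := hcpt.exists_isMinOn hne
    (f := fun x : ℝ × ℝ × ℝ × ℝ => x.1) continuous_fst.continuousOn
  have hx₀pos : 0 < x₀.1 := by
    rcases hx₀ with ⟨t, ht, rfl⟩ | ⟨t, ht, rfl⟩
    · exact hr _ (hm1 t ht)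
    · exact hr _ (hm2 t ht)
  obtain ⟨R, hR⟩ := hcpt.isBounded.subset_closedBall 0
  -- A compact convex set that contains both trajectories and stays off the axis, where the C¹ field
  -- is Lipschitz.
  set D : Set (ℝ × ℝ × ℝ × ℝ) := {x | x₀.1 ≤ x.1} ∩ Metric.closedBall 0 R with hD
  have hDc : IsCompact D :=
    (isCompact_closedBall 0 R).inter_left (isClosed_le continuous_const continuous_fst)
  have hDconv : Convex ℝ D := by
    refine Convex.inter ?_ (convex_closedBall 0 R)
    exact convex_halfSpace_ge (f := fun x : ℝ × ℝ × ℝ × ℝ => x.1)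
      ⟨fun _ _ => rfl, fun _ _ => rfl⟩ x₀.1
  have hDs : D ⊆ {x | 0 < x.1} := fun x hx => hx₀pos.trans_le hx.1
  obtain ⟨L, hL⟩ := ((contDiffOn_weingartenField hg).mono hDs).exists_lipschitzOnWith
    one_ne_zero hDconv hDc
  have hin : f '' Icc 0 σ ∪ f' '' Icc 0 σ ⊆ D := fun x hx => ⟨hmin hx, hR hx⟩
  have heq := ODE_solution_unique_of_mem_Icc_right (v := fun _ => weingartenField g)
    (s := fun _ => D) (K := L) (fun t _ => hL) hc1
    (fun t ht => (hd1 t ⟨ht.1, ht.2.le⟩).hasDerivWithinAt)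
    (fun t ht => hin (Or.inl ⟨t, ⟨ht.1, ht.2.le⟩, rfl⟩)) hc2
    (fun t ht => (hd2 t ⟨ht.1, ht.2.le⟩).hasDerivWithinAt)
    (fun t ht => hin (Or.inr ⟨t, ⟨ht.1, ht.2.le⟩, rfl⟩)) (by simp [hf, hf', hc])
  have h := heq (right_mem_Icc.2 hσ)
  simp only [hf, hf', Prod.mk.injEq] at h
  obtain ⟨h1, -, h3, h4⟩ := h
  have m1 := hm1 σ (right_mem_Icc.2 hσ)
  have m2 := hm2 σ (right_mem_Icc.2 hσ)
  refine ⟨h1, h3, ?_, ?_⟩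
  · rw [(hW _ m1).curv_eq, (hW _ m2).curv_eq]
    change g (u _) + u _ = g (u _) + u _
    rw [h4]
  · rw [(hW _ m1).parallelCurv_eq, (hW _ m2).parallelCurv_eq]
    change g (u _) - u _ = g (u _) - u _
    rw [h4]

/-! ### Bounds between contacts with the axis, and along the whole profile. -/

/-- Either r increases up to `b`, and then r(b) > 0; or there is a first vertical tangent, at `s₁`,
and reflection about it transfers to the rest of the arc the bounds before `s₁` and the angle at the
pole. -/
theorem bounds_of_pos (hg : IsEllipticRelation g) (hg0 : 0 ≤ g 0)
    (P : IsProfile (Icc a b) r c d k) (hab : a < b) (hra : r a = 0) (hda : d a = 0)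
    (hr : ∀ s ∈ Ioo a b, 0 < r s) (hW : ∀ s ∈ Ioo a b, RelationAt g r d k s) :
    (∀ s ∈ Ioo a b, |k s| ≤ 1 + 4 * |g 0| ∧ |parallelCurv r d k s| ≤ 1 + 4 * |g 0|) ∧
      (r b = 0 → d b = 0) := by
  rw [abs_of_nonneg hg0]
  have asc : ∀ e ∈ Ioc a b, (∀ s ∈ Ioo a e, 0 < c s) → ∀ s ∈ Ioo a e,
      |k s| ≤ 1 + 4 * g 0 ∧ |parallelCurv r d k s| ≤ 1 + 4 * g 0 := fun e he hc s hs => by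
    have h := (P.mono fun x hx => ⟨hx.1, hx.2.le.trans he.2⟩ : IsProfile (Ico a e) r c d k
      ).ascending_bounds hg hg0 hra hda (fun s hs => hr s ⟨hs.1, hs.2.trans_le he.2⟩) hc
      (fun s hs => hW s ⟨hs.1, hs.2.trans_le he.2⟩) hs
    rw [abs_of_nonneg h.1, abs_of_nonneg h.2.2.1]
    exact ⟨by linarith, h.2.2.2⟩
  have hrc : ∀ x ∈ Icc a b, ContinuousAt r x := fun x hx => (P.1 x hx).continuousAt
  have hdc : ∀ x ∈ Icc a b, ContinuousAt d x := fun x hx => (P.3 x hx).continuousAt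
  have hcc : ContinuousOn c (Icc a b) := fun x hx => (P.2 x hx).continuousAt.continuousWithinAt
  by_cases hall : ∀ s ∈ Ioo a b, 0 < c s
  · refine ⟨asc b ⟨hab, le_rfl⟩ hall, fun hb => absurd hb (ne_of_gt ?_)⟩
    have hm : (a + b) / 2 ∈ Ioo a b := ⟨by linarith, by linarith⟩
    have h1 := le_sub_of_le_hasDerivAt (f := r) (C := 0) hm.2.le
      (fun x hx => (hrc x ⟨hm.1.le.trans hx.1, hx.2⟩).continuousWithinAt)
      (fun z hz => P.1 z ⟨(hm.1.trans hz.1).le, hz.2.le⟩)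
      (fun z hz => (hall z ⟨hm.1.trans hz.1, hz.2⟩).le)
    have h2 := hr _ hm
    linarith
  · push Not at hall
    obtain ⟨s₀, hs₀, hcs₀⟩ := hall
    have hca : 0 < c a := by
      have h1 := P.5 a ⟨le_rfl, hab.le⟩
      rw [hda] at h1
      have h2 : 0 ≤ c a := by
        have h3 := ((P.1 a ⟨le_rfl, hab.le⟩).tendsto_slope).mono_left
          (nhdsWithin_mono a (fun x (hx : a < x) => hx.ne') : 𝓝[>] a ≤ 𝓝[≠] a)
        refine ge_of_tendsto h3 ?_
        filter_upwards [Ioo_mem_nhdsGT hab] with x hx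
        rw [slope_def_field, hra, sub_zero]
        exact div_nonneg (hr x hx).le (by linarith [hx.1])
      rcases eq_or_lt_of_le h2 with h3 | h3
      · rw [← h3] at h1; norm_num at h1
      · exact h3
    obtain ⟨s₁, hs₁, hmin⟩ : ∃ s₁, IsLeast {x ∈ Icc a b | c x ≤ 0} s₁ :=
      (isCompact_Icc.of_isClosed_subset
        (hcc.preimage_isClosed_of_isClosed isClosed_Icc isClosed_Iic)
        fun x hx => hx.1).exists_isLeast ⟨s₀, ⟨hs₀.1.le, hs₀.2.le⟩, hcs₀⟩
    have hs₁a : a < s₁ := lt_of_le_of_ne hs₁.1.1 fun h => by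
      have := hs₁.2
      rw [← h] at this; linarith
    have hs₁b : s₁ < b := (hmin ⟨⟨hs₀.1.le, hs₀.2.le⟩, hcs₀⟩).trans_lt hs₀.2
    have hpos : ∀ s ∈ Ioo a s₁, 0 < c s := fun s hs => by
      by_contra hn
      exact absurd (hmin ⟨⟨hs.1.le, (hs.2.trans hs₁b).le⟩, not_lt.1 hn⟩) (not_le.2 hs.2)
    have hcs₁ : c s₁ = 0 := by
      refine le_antisymm hs₁.2 (ge_of_tendsto (x := 𝓝[<] s₁) (f := c)
        ((P.2 s₁ hs₁.1).continuousAt.tendsto.mono_left nhdsWithin_le_nhds) ?_)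
      filter_upwards [Ioo_mem_nhdsLT hs₁a] with x hx using (hpos x hx).le
    have hlow := asc s₁ ⟨hs₁a, hs₁b.le⟩ hpos
    have hmid : |k s₁| ≤ 1 + 4 * g 0 ∧ |parallelCurv r d k s₁| ≤ 1 + 4 * g 0 := by
      have hk : ContinuousAt (fun s => |k s|) s₁ := (P.4 s₁ hs₁.1).continuousAt.abs
      have hK : ContinuousAt (fun s => |parallelCurv r d k s|) s₁ :=
        (P.continuousAt_parallelCurv hs₁.1
          fun h => absurd h (hr s₁ ⟨hs₁a, hs₁b⟩).ne').abs
      constructor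
      · refine le_of_tendsto (x := 𝓝[<] s₁) (hk.tendsto.mono_left nhdsWithin_le_nhds) ?_
        filter_upwards [Ioo_mem_nhdsLT hs₁a] with x hx using (hlow x hx).1
      · refine le_of_tendsto (x := 𝓝[<] s₁) (hK.tendsto.mono_left nhdsWithin_le_nhds) ?_
        filter_upwards [Ioo_mem_nhdsLT hs₁a] with x hx using (hlow x hx).2
    have hsymm : ∀ t ∈ Ioo s₁ b, a < 2 * s₁ - t → r t = r (2 * s₁ - t) ∧ d t = d (2 * s₁ - t) ∧
        k t = k (2 * s₁ - t) ∧ parallelCurv r d k t = parallelCurv r d k (2 * s₁ - t) :=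
      fun t ht hta => by
      have := (P.mono Ioo_subset_Icc_self).symm_of_vertical hg hr hW (s₁ := s₁) (σ := t - s₁)
        (by linarith [ht.1]) (by linarith) (by linarith [ht.2]) hcs₁
      rwa [show s₁ + (t - s₁) = t by ring, show s₁ - (t - s₁) = 2 * s₁ - t by ring] at this
    -- Continuity carries the symmetry to the endpoints of the arc, where the contacts with the axis
    -- lie.
    have hlim : ∀ x ∈ Ioc s₁ b, a ≤ 2 * s₁ - x → r x = r (2 * s₁ - x) ∧ d x = d (2 * s₁ - x) := by
      intro x hx hxa
      have hx' : x ∈ Icc a b := ⟨(hs₁a.trans hx.1).le, hx.2⟩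
      have hx'' : 2 * s₁ - x ∈ Icc a b := ⟨hxa, by linarith [hx.1]⟩
      have hev : ∀ᶠ t in 𝓝[<] x, r t = r (2 * s₁ - t) ∧ d t = d (2 * s₁ - t) := by
        filter_upwards [Ioo_mem_nhdsLT hx.1] with t ht
        have := hsymm t ⟨ht.1, ht.2.trans_le hx.2⟩ (by linarith [ht.2])
        exact ⟨this.1, this.2.1⟩
      have hrefl : ∀ f : ℝ → ℝ, ContinuousAt f (2 * s₁ - x) →
          Tendsto (fun t => f (2 * s₁ - t)) (𝓝[<] x) (𝓝 (f (2 * s₁ - x))) := fun f hf =>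
        (ContinuousAt.comp (f := fun t => 2 * s₁ - t) hf
          (by fun_prop)).tendsto.mono_left nhdsWithin_le_nhds
      constructor
      · refine tendsto_nhds_unique ((hrc x hx').tendsto.mono_left nhdsWithin_le_nhds)
          ((hrefl r (hrc _ hx'')).congr' ?_)
        filter_upwards [hev] with t ht using ht.1.symm
      · refine tendsto_nhds_unique ((hdc x hx').tendsto.mono_left nhdsWithin_le_nhds)
          ((hrefl d (hdc _ hx'')).congr' ?_)
        filter_upwards [hev] with t ht using ht.2.symm
    -- The arc cannot go past the mirror image of its pole, since r vanishes there.
    have hb : b ≤ 2 * s₁ - a := by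
      by_contra hn
      have h1 := (hlim (2 * s₁ - a) ⟨by linarith, (not_le.1 hn).le⟩ (by linarith)).1
      rw [show 2 * s₁ - (2 * s₁ - a) = a by ring, hra] at h1
      exact (hr _ ⟨by linarith, not_le.1 hn⟩).ne' h1
    refine ⟨fun s hs => ?_, fun hrb => ?_⟩
    · rcases lt_trichotomy s s₁ with h | h | h
      · exact hlow s ⟨hs.1, h⟩
      · rw [h]; exact hmid
      · have h1 : a < 2 * s₁ - s := by linarith [hs.2]
        obtain ⟨-, -, h2, h3⟩ := hsymm s ⟨h, hs.2⟩ h1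
        rw [h2, h3]
        exact hlow _ ⟨h1, by linarith⟩
    · obtain ⟨h1, h2⟩ := hlim b ⟨hs₁b, le_rfl⟩ (by linarith)
      have h3 : 2 * s₁ - b = a := by
        by_contra hne
        have h4 : a < 2 * s₁ - b := lt_of_le_of_ne (by linarith) (Ne.symm hne)
        exact (hr _ ⟨h4, by linarith⟩).ne' (h1 ▸ hrb)
      rw [h2, h3, hda]

theorem relationAt_neg {r' d' k' : ℝ → ℝ} {s s' : ℝ} (hk : k' s' = -k s)
    (hK : parallelCurv r' d' k' s' = -parallelCurv r d k s) (h : RelationAt g r d k s) :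
    RelationAt (fun u => -g (-u)) r' d' k' s' := by
  unfold RelationAt at *
  rw [hk, hK]
  beta_reduce
  rw [show -((-k s - -parallelCurv r d k s) / 2) = (k s - parallelCurv r d k s) / 2 by ring,
    ← h]
  ring

/-- Curvature bounds on an arc that starts at the axis and does not meet it again. -/
theorem bounds_of_ne_zero (hg : IsEllipticRelation g)
    (P : IsProfile (Icc a b) r c d k) (hab : a < b) (hra : r a = 0) (hda : d a = 0)
    (hr : ∀ s ∈ Ioo a b, r s ≠ 0) (hW : ∀ s ∈ Ioo a b, RelationAt g r d k s) :
    (∀ s ∈ Ioo a b, |k s| ≤ 1 + 4 * |g 0| ∧ |parallelCurv r d k s| ≤ 1 + 4 * |g 0|) ∧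
      (r b = 0 → d b = 0) := by
  -- Reflection in a horizontal plane changes the sign of g(0).
  wlog hg0 : 0 ≤ g 0 generalizing g d k
  · have := this hg.neg_comp_neg P.flip_height (by simp [hda])
      (fun s hs => relationAt_neg rfl (parallelCurv_flip_height s) (hW s hs))
      (by simp only [neg_zero]; linarith [not_le.1 hg0])
    simpa [parallelCurv_flip_height] using this
  have hrc : ContinuousOn r (Ioo a b) := fun x hx =>
    (P.1 x ⟨hx.1.le, hx.2.le⟩).continuousAt.continuousWithinAt
  have hsign : (∀ s ∈ Ioo a b, 0 < r s) ∨ ∀ s ∈ Ioo a b, r s < 0 := by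
    by_contra hn
    push Not at hn
    obtain ⟨⟨x, hx, hx0⟩, y, hy, hy0⟩ := hn
    obtain ⟨z, hz, hz0⟩ := (isPreconnected_Ioo.image r hrc).ordConnected.out
      (mem_image_of_mem r hx) (mem_image_of_mem r hy) ⟨hx0, hy0⟩
    exact hr z hz hz0
  rcases hsign with h | h
  · exact P.bounds_of_pos hg hg0 hab hra hda h hW
  -- The half-turn (r, h) ↦ (-r, -h) of the vertical plane preserves both curvatures, hence the
  -- relation `g`.
  · have hr' : ∀ s ∈ Ioo a b, 0 < (fun s => -r s) s := fun s hs => neg_pos.2 (h s hs)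
    have hK : ∀ s, parallelCurv (fun s => -r s) (fun s => -d s) k s = parallelCurv r d k s :=
      fun s => by
        have := parallelCurv_flip_height (r := fun s => -r s) (d := d) (k := fun s => -k s) s
        simpa [parallelCurv_flip_radius] using this
    have := bounds_of_pos hg hg0 (by simpa using P.flip_radius.flip_height) hab
      (by simp [hra]) (by simp [hda]) hr'
      (fun s hs => by
        unfold RelationAt
        rw [hK]; exact hW s hs)
    simpa [hK] using this

/-- The curve satisfies an elliptic relation on every arc off the axis, with curvature `±A` at
umbilic points. -/
def ArcRelation (A : ℝ) (I : Set ℝ) (r d k : ℝ → ℝ) : Prop :=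
  ∀ a b : ℝ, Icc a b ⊆ I → (∀ s ∈ Ioo a b, r s ≠ 0) →
    ∃ g, IsEllipticRelation g ∧ |g 0| = A ∧ ∀ s ∈ Ioo a b, RelationAt g r d k s

/-- The arc to which the previous bounds apply starts at z, the last orthogonal contact with the
axis up to `s`. The relation may change from arc to arc, but only |g(0)| enters the bound. -/
theorem bounds_right {A : ℝ} (hI : IsOpen I) (hI' : I.OrdConnected) (P : IsProfile I r c d k)
    (hW : ArcRelation A I r d k) {s₀ : ℝ} (hs₀ : s₀ ∈ I) (hr₀ : r s₀ = 0) (hd₀ : d s₀ = 0)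
    {s : ℝ} (hs : s ∈ I) (hle : s₀ ≤ s) :
    (r s = 0 → d s = 0) ∧
      (r s ≠ 0 → |k s| ≤ 1 + 4 * A ∧ |parallelCurv r d k s| ≤ 1 + 4 * A) := by
  have hsub : Icc s₀ s ⊆ I := hI'.out hs₀ hs
  have hrc : ContinuousOn r I := fun x hx => (P.1 x hx).continuousAt.continuousWithinAt
  have hdc : ContinuousOn d I := fun x hx => (P.3 x hx).continuousAt.continuousWithinAt
  obtain ⟨z, ⟨hz, hrz, hdz⟩, hmax⟩ :
      ∃ z, IsGreatest {x ∈ Icc s₀ s | r x = 0 ∧ d x = 0} z := by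
    refine (isCompact_Icc.of_isClosed_subset ?_ fun x hx => hx.1).exists_isGreatest
      ⟨s₀, ⟨le_rfl, hle⟩, hr₀, hd₀⟩
    have := ((hrc.mono hsub).prodMk (hdc.mono hsub)).preimage_isClosed_of_isClosed
      isClosed_Icc (isClosed_singleton (x := ((0 : ℝ), (0 : ℝ))))
    convert this using 1
    ext x; simp [Prod.ext_iff]
  rcases eq_or_lt_of_le hz.2 with hzs | hzs
  · subst hzs
    exact ⟨fun _ => hdz, fun h => absurd hrz h⟩
  have hne : ∀ᶠ x in 𝓝[>] z, r x ≠ 0 := by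
    have hcz : c z ≠ 0 := fun h => by
      have := P.5 z (hsub hz)
      rw [h, hdz] at this; norm_num at this
    have := (P.1 z (hsub hz)).eventually_ne (c := 0) hcz
    exact this.filter_mono (nhdsWithin_mono z fun x (hx : z < x) => hx.ne')
  -- The zero z of r is isolated; starting from y, compactness provides a first later zero, if there
  -- is any.
  obtain ⟨y, hy, hzy⟩ : ∃ y ∈ Ioc z s, ∀ x ∈ Ioo z y, r x ≠ 0 := by
    obtain ⟨y, hy, h⟩ := (mem_nhdsGT_iff_exists_Ioo_subset' (show z < s from hzs)).1 hne
    refine ⟨min y s, ⟨lt_min hy hzs, min_le_right _ _⟩, fun x hx => ?_⟩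
    exact h ⟨hx.1, hx.2.trans_le (min_le_left _ _)⟩
  -- The first zero of r after z would again be an orthogonal contact, against the maximality of z.
  have hnz : ∀ x ∈ Ioo z s, r x ≠ 0 := by
    intro x hx hrx
    have hyx : y ≤ x := by
      by_contra hn
      exact hzy x ⟨hx.1, not_le.1 hn⟩ hrx
    obtain ⟨b, ⟨hb, hrb⟩, hbmin⟩ : ∃ b, IsLeast {w ∈ Icc y s | r w = 0} b :=
      (isCompact_Icc.of_isClosed_subset
        ((hrc.mono fun w hw => hsub ⟨hz.1.trans (hy.1.le.trans hw.1), hw.2⟩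
          ).preimage_isClosed_of_isClosed isClosed_Icc isClosed_singleton)
        fun w hw => hw.1).exists_isLeast ⟨x, ⟨hyx, hx.2.le⟩, hrx⟩
    have hzb : z < b := hy.1.trans_le hb.1
    have hIb : Icc z b ⊆ I := fun w hw => hsub ⟨hz.1.trans hw.1, hw.2.trans hb.2⟩
    have hrne : ∀ w ∈ Ioo z b, r w ≠ 0 := fun w hw hrw => by
      rcases lt_or_ge w y with h | h
      · exact hzy w ⟨hw.1, h⟩ hrw
      · exact absurd (hbmin ⟨⟨h, hw.2.le.trans hb.2⟩, hrw⟩) (not_le.2 hw.2)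
    obtain ⟨g, hg, -, hgW⟩ := hW z b hIb hrne
    have := ((P.mono hIb).bounds_of_ne_zero hg hzb hrz hdz hrne hgW).2 hrb
    exact absurd (hmax ⟨⟨hz.1.trans hzb.le, hb.2⟩, hrb, this⟩) (not_le.2 hzb)
  have hIs : Icc z s ⊆ I := fun w hw => hsub ⟨hz.1.trans hw.1, hw.2⟩
  refine ⟨fun h => ?_, fun h => ?_⟩
  · obtain ⟨g, hg, -, hgW⟩ := hW z s hIs hnz
    exact ((P.mono hIs).bounds_of_ne_zero hg hzs hrz hdz hnz hgW).2 h
  -- The bounds hold in the interior of an arc, so the arc is prolonged slightly beyond `s`.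
  · have hev : ∀ᶠ x in 𝓝 s, x ∈ I ∧ r x ≠ 0 := by
      filter_upwards [hI.mem_nhds hs, (P.1 s hs).continuousAt.eventually_ne h] with x h1 h2
      exact ⟨h1, h2⟩
    obtain ⟨δ, hδ, hball⟩ := Metric.eventually_nhds_iff.1 hev
    have hnear : ∀ x, s ≤ x → x ≤ s + δ / 2 → x ∈ I ∧ r x ≠ 0 := fun x h1 h2 => hball (by
      rw [Real.dist_eq, abs_of_nonneg (by linarith)]; linarith)
    have hIb : Icc z (s + δ / 2) ⊆ I := fun w hw => by
      rcases le_total w s with h1 | h1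
      · exact hIs ⟨hw.1, h1⟩
      · exact (hnear w h1 hw.2).1
    have hrne : ∀ w ∈ Ioo z (s + δ / 2), r w ≠ 0 := fun w hw => by
      rcases lt_or_ge w s with h1 | h1
      · exact hnz w ⟨hw.1, h1⟩
      · exact (hnear w h1 hw.2.le).2
    obtain ⟨g, hg, hgA, hgW⟩ := hW z _ hIb hrne
    rw [← hgA]
    exact ((P.mono hIb).bounds_of_ne_zero hg (by linarith) hrz hdz hrne hgW).1 s
      ⟨hzs, by linarith⟩

/-- A Weingarten profile that meets the axis orthogonally once does so at all its points on the axis,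
and has bounded curvatures. -/
theorem bounds {A : ℝ} (hI : IsOpen I) (hI' : I.OrdConnected) (P : IsProfile I r c d k)
    (hW : ArcRelation A I r d k) {s₀ : ℝ} (hs₀ : s₀ ∈ I) (hr₀ : r s₀ = 0) (hd₀ : d s₀ = 0)
    {s : ℝ} (hs : s ∈ I) :
    (r s = 0 → d s = 0) ∧
      (r s ≠ 0 → |k s| ≤ 1 + 4 * A ∧ |parallelCurv r d k s| ≤ 1 + 4 * A) := by
  rcases le_total s₀ s with h | h
  · exact P.bounds_right hI hI' hW hs₀ hr₀ hd₀ hs h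
  · have hJ : IsOpen {s : ℝ | -s ∈ I} := hI.preimage continuous_neg
    have hJ' : {s : ℝ | -s ∈ I}.OrdConnected := ⟨fun x hx y hy z hz =>
      hI'.out hy hx ⟨neg_le_neg hz.2, neg_le_neg hz.1⟩⟩
    have hW' : ArcRelation A {s : ℝ | -s ∈ I} (fun s => r (-s)) (fun s => -d (-s))
        (fun s => -k (-s)) := fun a b hab hr => by
      obtain ⟨g, hg, hgA, hgW⟩ := hW (-b) (-a)
        (fun x hx => by
          have : -x ∈ {s : ℝ | -s ∈ I} := hab ⟨by linarith [hx.2], by linarith [hx.1]⟩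
          simpa using this)
        (fun x hx => by
          have := hr (-x) ⟨by linarith [hx.2], by linarith [hx.1]⟩
          simpa using this)
      refine ⟨_, hg.neg_comp_neg, by simpa using hgA, fun x hx => ?_⟩
      exact relationAt_neg rfl (parallelCurv_reverse x)
        (hgW (-x) ⟨by linarith [hx.2], by linarith [hx.1]⟩)
    have := P.reverse.bounds_right hJ hJ' hW' (s₀ := -s₀) (s := -s) (by simpa using hs₀)
      (by simpa using hr₀) (by simpa using hd₀) (by simpa using hs) (neg_le_neg h)
    simpa [parallelCurv_reverse] using this

end IsProfile

/-! ### Lorentzian algebra and the frame adapted to the axis. -/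

theorem lor_comm (x y : L4) : lor x y = lor y x := by unfold lor; ring
theorem lor_add_left (x y z : L4) : lor (x + y) z = lor x z + lor y z := by
  simp only [lor, Pi.add_apply]; ring
theorem lor_add_right (x y z : L4) : lor x (y + z) = lor x y + lor x z := by
  simp only [lor, Pi.add_apply]; ring
theorem lor_sub_left (x y z : L4) : lor (x - y) z = lor x z - lor y z := by
  simp only [lor, Pi.sub_apply]; ring
theorem lor_sub_right (x y z : L4) : lor x (y - z) = lor x y - lor x z := by
  simp only [lor, Pi.sub_apply]; ring
theorem lor_smul_left (a : ℝ) (x z : L4) : lor (a • x) z = a * lor x z := by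
  simp only [lor, Pi.smul_apply, smul_eq_mul]; ring
theorem lor_smul_right (a : ℝ) (x z : L4) : lor x (a • z) = a * lor x z := by
  simp only [lor, Pi.smul_apply, smul_eq_mul]; ring
theorem lor_xi (x : L4) : lor x xi = x 3 := by simp [lor, xi]
theorem xi_lor (x : L4) : lor xi x = x 3 := by simp [lor, xi]
theorem xi_three : xi 3 = 1 := rfl

theorem horizontalPart_eq (x : L4) : horizontalPart x = x - x 3 • xi := by
  ext i; fin_cases i <;> simp [horizontalPart, xi]

theorem continuous_lor : Continuous fun x : L4 × L4 => lor x.1 x.2 := by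
  unfold lor; fun_prop

namespace IsAxisFrame

variable {q e₁ e₂ : L4}

theorem lor_base (F : IsAxisFrame q e₁ e₂) : lor q q = -1 := by
  have h1 := F.1.1
  have h2 := F.2.1
  simp only [lor, h2]; linarith

/-- The unit horizontal vector `cos t e₁ + sin t e₂`. -/
def radial (e₁ e₂ : L4) (t : ℝ) : L4 := Real.cos t • e₁ + Real.sin t • e₂

/-- The unit horizontal vector `-sin t e₁ + cos t e₂`. -/
def angular (e₁ e₂ : L4) (t : ℝ) : L4 := -Real.sin t • e₁ + Real.cos t • e₂

theorem rotate (F : IsAxisFrame q e₁ e₂) (t : ℝ) :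
    IsAxisFrame q (radial e₁ e₂ t) (angular e₁ e₂ t) := by
  obtain ⟨hq, hq3, h13, h23, h1q, h2q, h11, h22, h12⟩ := F
  have h21 : lor e₂ e₁ = 0 := by rw [lor_comm]; exact h12
  have hcs := Real.cos_sq_add_sin_sq t
  refine ⟨hq, hq3, by simp [radial, h13, h23], by simp [angular, h13, h23], ?_, ?_, ?_, ?_, ?_⟩ <;>
  simp only [radial, angular, lor_add_left, lor_add_right, lor_smul_left, lor_smul_right, h1q, h2q,
    h11, h22, h12, h21]
  · ring
  · ring
  · linear_combination hcs
  · linear_combination hcs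
  · ring

/-- Orthonormality of the frame is a matrix identity AB = 1. For square matrices it gives BA = 1,
which is the completeness of the frame. -/
theorem expand (F : IsAxisFrame q e₁ e₂) (y : L4) :
    y = lor y e₁ • e₁ + lor y e₂ • e₂ - lor y q • q + y 3 • xi := by
  have hqq := F.lor_base
  obtain ⟨hq, hq3, h13, h23, h1q, h2q, h11, h22, h12⟩ := F
  simp only [lor, hq3, h13, h23] at hqq h1q h2q h11 h22 h12
  set A : Matrix (Fin 3) (Fin 3) ℝ :=
    !![e₁ 0, e₁ 1, e₁ 2; e₂ 0, e₂ 1, e₂ 2; q 0, q 1, q 2] with hA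
  set B : Matrix (Fin 3) (Fin 3) ℝ :=
    !![e₁ 0, e₂ 0, -q 0; e₁ 1, e₂ 1, -q 1; -e₁ 2, -e₂ 2, q 2] with hB
  have hAB : A * B = 1 := by
    ext i j
    fin_cases i <;> fin_cases j <;>
      simp [hA, hB, Matrix.mul_apply, Fin.sum_univ_three] <;> linarith
  have hBA : B * A = 1 := mul_eq_one_comm.1 hAB
  have key : ∀ i j, (B * A) i j = (1 : Matrix (Fin 3) (Fin 3) ℝ) i j := fun i j => by rw [hBA]
  have h00 := key 0 0
  have h01 := key 0 1
  have h02 := key 0 2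
  have h10 := key 1 0
  have h11' := key 1 1
  have h12' := key 1 2
  have h20 := key 2 0
  have h21 := key 2 1
  have h22' := key 2 2
  simp [hA, hB, Matrix.mul_apply, Fin.sum_univ_three] at h00 h01 h02 h10 h11' h12' h20 h21 h22'
  ext i
  fin_cases i <;> simp [lor, xi, hq3, h13, h23]
  · linear_combination -y 0 * h00 - y 1 * h10 - y 2 * h20
  · linear_combination -y 0 * h01 - y 1 * h11' - y 2 * h21
  · linear_combination -y 0 * h02 - y 1 * h12' - y 2 * h22'

theorem hasDerivAt_radial (t : ℝ) : HasDerivAt (radial e₁ e₂) (angular e₁ e₂ t) t :=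
  ((Real.hasDerivAt_cos t).smul_const e₁).add ((Real.hasDerivAt_sin t).smul_const e₂)

theorem continuous_radial : Continuous (radial e₁ e₂) :=
  continuous_iff_continuousAt.2 fun t => (hasDerivAt_radial t).continuousAt

/-- The unit vector tangent to the horizontal geodesic that leaves `q` with velocity `e`, at distance
`ρ`. -/
def outward (q e : L4) (ρ : ℝ) : L4 := Real.cosh ρ • e + Real.sinh ρ • q

/-- The position vector in `ℍ²` of the point at distance `ρ` of `q` in the direction of `e`. -/
def position (q e : L4) (ρ : ℝ) : L4 := Real.sinh ρ • e + Real.cosh ρ • q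

theorem hasDerivAt_position {r : ℝ → ℝ} {c s : ℝ} (e : L4) (hr : HasDerivAt r c s) :
    HasDerivAt (fun s => position q e (r s)) (c • outward q e (r s)) s := by
  refine ((hr.sinh.smul_const e).add (hr.cosh.smul_const q)).congr_deriv ?_
  simp only [outward]; module

theorem hasDerivAt_outward {r : ℝ → ℝ} {c s : ℝ} (e : L4) (hr : HasDerivAt r c s) :
    HasDerivAt (fun s => outward q e (r s)) (c • position q e (r s)) s := by
  refine ((hr.cosh.smul_const e).add (hr.sinh.smul_const q)).congr_deriv ?_
  simp only [position]; module

theorem axisRotation_planePoint (F : IsAxisFrame q e₁ e₂) (r h t : ℝ) :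
    axisRotation q e₁ e₂ t (planePoint q e₁ r h) =
      position q (radial e₁ e₂ t) r + h • xi := by
  have hqq := F.lor_base
  obtain ⟨hq, hq3, h13, h23, h1q, h2q, h11, h22, h12⟩ := F
  have h21 : lor e₂ e₁ = 0 := by rw [lor_comm]; exact h12
  have hq1 : lor q e₁ = 0 := by rw [lor_comm]; exact h1q
  have hq2 : lor q e₂ = 0 := by rw [lor_comm]; exact h2q
  simp only [axisRotation, planePoint, lor_add_left, lor_smul_left, h11, h12, hq1, hq2, xi_lor, h13,
    h23, h1q, hqq, hq3, Pi.add_apply, Pi.smul_apply, xi_three, position, radial, smul_eq_mul]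
  module

/-- Products of the vectors of the adapted frame along a parallel. -/
theorem lor_adapted (F : IsAxisFrame q e₁ e₂) (ρ : ℝ) :
    lor (outward q e₁ ρ) (outward q e₁ ρ) = 1 ∧ lor (outward q e₁ ρ) e₂ = 0 ∧
      lor (outward q e₁ ρ) xi = 0 ∧ lor (position q e₁ ρ) (outward q e₁ ρ) = 0 ∧
      lor (position q e₁ ρ) e₂ = 0 ∧ lor (position q e₁ ρ) xi = 0 ∧
      lor (position q e₁ ρ) q = -Real.cosh ρ := by
  have hqq := F.lor_base
  obtain ⟨hq, hq3, h13, h23, h1q, h2q, h11, h22, h12⟩ := F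
  have hq1 : lor q e₁ = 0 := by rw [lor_comm]; exact h1q
  have hq2 : lor q e₂ = 0 := by rw [lor_comm]; exact h2q
  have hcs := Real.cosh_sq ρ
  simp only [outward, position, lor_add_left, lor_add_right, lor_smul_left, lor_smul_right, h11,
    h12, hq1, hq2, h1q, lor_xi, hq3, h13, hqq, Pi.add_apply, Pi.smul_apply, smul_eq_mul]
  refine ⟨by linear_combination hcs, by ring, by ring, by ring, by ring, by ring, by ring⟩

/-- A unit vector orthogonal to the parallel and to the meridian is the normal `c ξ - d T`, up to
sign. -/
theorem eq_smul_normal (F : IsAxisFrame q e₁ e₂) {ρ c d : ℝ} {N : L4} (hcd : c ^ 2 + d ^ 2 = 1)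
    (h1 : lor N (position q e₁ ρ) = 0) (h2 : lor N e₂ = 0)
    (h3 : lor N (c • outward q e₁ ρ + d • xi) = 0) (h4 : lor N N = 1) :
    lor N (c • xi - d • outward q e₁ ρ) ^ 2 = 1 ∧
      N = lor N (c • xi - d • outward q e₁ ρ) • (c • xi - d • outward q e₁ ρ) := by
  have hN := F.expand N
  have h4' : lor N e₁ ^ 2 - lor N q ^ 2 + N 3 ^ 2 = 1 := by
    have h5 : lor N N = lor (lor N e₁ • e₁ + lor N e₂ • e₂ - lor N q • q + N 3 • xi) N :=
      congrArg (fun y => lor y N) hN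
    simp only [lor_add_left, lor_sub_left, lor_smul_left, xi_lor, lor_comm e₁ N, lor_comm e₂ N,
      lor_comm q N, h2] at h5
    linarith
  simp only [h2, position, outward, lor_add_right, lor_sub_right, lor_smul_right, lor_xi]
    at h1 h3 hN ⊢
  set A := lor N e₁
  set Q := lor N q
  set Z := N 3
  have hcs := Real.cosh_sq ρ
  set C := Real.cosh ρ
  set Sh := Real.sinh ρ
  -- Here τ is the component of `N` along `outward`, so that N = τ T + Z ξ. Orthogonality to the
  -- meridian, cτ + dZ = 0, then makes (τ, Z) proportional to (-d, c).
  have hA : A = (C * A + Sh * Q) * C := by linear_combination -A * hcs - Sh * h1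
  have hQ : Q = -(C * A + Sh * Q) * Sh := by linear_combination -Q * hcs + C * h1
  set τ := C * A + Sh * Q
  have hτ : τ ^ 2 + Z ^ 2 = 1 := by
    rw [hA, hQ] at h4'
    linear_combination h4' - τ ^ 2 * hcs
  have e1 : τ = -d * (c * Z - d * τ) := by linear_combination c * h3 - τ * hcd
  have e2 : Z = c * (c * Z - d * τ) := by linear_combination d * h3 - Z * hcd
  refine ⟨by linear_combination (c ^ 2 + d ^ 2) * hτ + hcd - (c * τ + d * Z) * h3, ?_⟩
  rw [hN]
  have e3 : A = -(d * (c * Z - d * τ)) * C := by rw [hA]; linear_combination C * e1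
  have e4 : Q = (d * (c * Z - d * τ)) * Sh := by rw [hQ]; linear_combination -Sh * e1
  generalize c * Z - d * τ = ε at e2 e3 e4
  rw [e2, e3, e4]
  module

end IsAxisFrame

/-! ### Principal curvatures read in a basis of principal directions. -/

namespace ImmersedSurface

variable {M : Type u} [TopologicalSpace M] [ChartedSpace (EuclideanSpace ℝ (Fin 2)) M]

/-- The differential of the immersion at `p`. -/
def mapDeriv (S : ImmersedSurface M) (p : M) : EuclideanSpace ℝ (Fin 2) →L[ℝ] L4 :=
  mfderiv (𝓡 2) 𝓘(ℝ, L4) S.map p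

/-- The differential of the unit normal at `p`. -/
def normalDeriv (S : ImmersedSurface M) (p : M) : EuclideanSpace ℝ (Fin 2) →L[ℝ] L4 :=
  mfderiv (𝓡 2) 𝓘(ℝ, L4) S.normal p

theorem apply_eq_sum_single (L : EuclideanSpace ℝ (Fin 2) →L[ℝ] L4)
    (v : EuclideanSpace ℝ (Fin 2)) :
    L v = v 0 • L (EuclideanSpace.single 0 1) + v 1 • L (EuclideanSpace.single 1 1) := by
  conv_lhs => rw [show v = v 0 • EuclideanSpace.single (0 : Fin 2) (1 : ℝ) +
    v 1 • EuclideanSpace.single (1 : Fin 2) (1 : ℝ) by ext i; fin_cases i <;> simp]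
  rw [map_add, map_smul, map_smul]

/-- Principal curvatures read off a basis `v₀, v₁` of principal directions. -/
theorem curvatures_of_principal (S : ImmersedSurface M) (p : M)
    (v : Fin 2 → EuclideanSpace ℝ (Fin 2)) (κ : Fin 2 → ℝ)
    (hG : lor (S.mapDeriv p (v 0)) (S.mapDeriv p (v 0)) *
      lor (S.mapDeriv p (v 1)) (S.mapDeriv p (v 1)) -
      lor (S.mapDeriv p (v 0)) (S.mapDeriv p (v 1)) ^ 2 ≠ 0)
    (hB : ∀ i j, -lor (S.normalDeriv p (v i)) (S.mapDeriv p (v j)) =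
      κ i * lor (S.mapDeriv p (v i)) (S.mapDeriv p (v j))) :
    S.meanCurvature p = (κ 0 + κ 1) / 2 ∧ S.extrinsicCurvature p = κ 0 * κ 1 ∧
      S.secondFormNorm p = Real.sqrt (κ 0 ^ 2 + κ 1 ^ 2) := by
  set W : Matrix (Fin 2) (Fin 2) ℝ := Matrix.of fun i j => v i j with hW
  have hm : ∀ i, S.mapDeriv p (v i) = v i 0 • S.dMap p 0 + v i 1 • S.dMap p 1 :=
    fun i => apply_eq_sum_single _ _
  have hn : ∀ i, S.normalDeriv p (v i) = v i 0 • S.dNormal p 0 + v i 1 • S.dNormal p 1 :=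
    fun i => apply_eq_sum_single _ _
  have h1 : W * S.firstForm p * W.transpose =
      Matrix.of fun i j => lor (S.mapDeriv p (v i)) (S.mapDeriv p (v j)) := by
    ext i j
    simp only [Matrix.mul_apply, Fin.sum_univ_two, Matrix.transpose_apply, hW, Matrix.of_apply,
      firstForm, hm, lor_add_left, lor_add_right, lor_smul_left, lor_smul_right]
    ring
  have h2 : W * S.secondForm p * W.transpose =
      Matrix.of fun i j => -lor (S.normalDeriv p (v i)) (S.mapDeriv p (v j)) := by
    ext i j
    simp only [Matrix.mul_apply, Fin.sum_univ_two, Matrix.transpose_apply, hW, Matrix.of_apply,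
      secondForm, hm, hn, lor_add_left, lor_add_right, lor_smul_left, lor_smul_right]
    ring
  have hdet : (W * S.firstForm p * W.transpose).det ≠ 0 := by
    rw [h1, Matrix.det_fin_two]
    simp only [Matrix.of_apply]
    rw [lor_comm (S.mapDeriv p (v 1)) (S.mapDeriv p (v 0)), ← sq]
    exact hG
  rw [Matrix.det_mul, Matrix.det_mul, Matrix.det_transpose] at hdet
  have hWd : W.det ≠ 0 := right_ne_zero_of_mul hdet
  have hGd : (S.firstForm p).det ≠ 0 := right_ne_zero_of_mul (left_ne_zero_of_mul hdet)
  have h3 : W * S.secondForm p * W.transpose =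
      Matrix.diagonal κ * W * S.firstForm p * W.transpose := by
    rw [h2, mul_assoc, mul_assoc, ← mul_assoc W, h1]
    ext i j
    rw [Matrix.diagonal_mul]
    exact hB i j
  have hWT : IsUnit W.transpose.det := by rw [Matrix.det_transpose]; exact hWd.isUnit
  have h4 : W * S.secondForm p = Matrix.diagonal κ * W * S.firstForm p := by
    have := congrArg (· * W.transpose⁻¹) h3
    simpa only [Matrix.mul_nonsing_inv_cancel_right _ _ hWT] using this
  set Q := W * S.firstForm p with hQ
  have hQd : IsUnit Q.det := by
    rw [hQ, Matrix.det_mul]; exact (mul_ne_zero hWd hGd).isUnit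
  -- `Q` conjugates the shape operator to diag(κ), from which the trace, the determinant and the
  -- trace of the square follow.
  have h5 : Q * S.shape p = Matrix.diagonal κ * Q := by
    rw [hQ, shape, mul_assoc, Matrix.mul_nonsing_inv_cancel_left _ _ hGd.isUnit, h4, mul_assoc]
  have h6 : S.shape p = Q⁻¹ * (Matrix.diagonal κ * Q) := by
    rw [← h5, Matrix.nonsing_inv_mul_cancel_left _ _ hQd]
  have h7 : S.shape p * S.shape p = Q⁻¹ * ((Matrix.diagonal κ * Matrix.diagonal κ) * Q) := by
    conv_lhs => rw [h6]
    rw [mul_assoc, mul_assoc (Matrix.diagonal κ), Matrix.mul_nonsing_inv_cancel_left _ _ hQd,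
      mul_assoc]
  refine ⟨?_, ?_, ?_⟩
  · rw [meanCurvature, h6, Matrix.trace_mul_comm, Matrix.mul_nonsing_inv_cancel_right _ _ hQd,
      Matrix.trace_diagonal, Fin.sum_univ_two]
  · rw [extrinsicCurvature, h6, Matrix.det_mul_comm, Matrix.mul_nonsing_inv_cancel_right _ _ hQd,
      Matrix.det_diagonal, Fin.prod_univ_two]
  · rw [secondFormNorm, h7, Matrix.trace_mul_comm, Matrix.mul_nonsing_inv_cancel_right _ _ hQd,
      Matrix.diagonal_mul_diagonal, Matrix.trace_diagonal, Fin.sum_univ_two, ← sq, ← sq]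

end ImmersedSurface

/-! ### Curvatures of rotational surfaces. -/

open IsAxisFrame

variable {M : Type u} [TopologicalSpace M] [ChartedSpace (EuclideanSpace ℝ (Fin 2)) M]

/-- The differential of a parametrization `X` of a surface. -/
def paramDeriv (X : ℝ × ℝ → M) (x : ℝ × ℝ) : ℝ × ℝ →L[ℝ] EuclideanSpace ℝ (Fin 2) :=
  mfderiv 𝓘(ℝ, ℝ × ℝ) (𝓡 2) X x

theorem hasFDerivAt_comp_param {F : Type*} [NormedAddCommGroup F] [NormedSpace ℝ F]
    {f : M → F} {X : ℝ × ℝ → M} {x : ℝ × ℝ} {f' : EuclideanSpace ℝ (Fin 2) →L[ℝ] F}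
    (hf : MDifferentiableAt (𝓡 2) 𝓘(ℝ, F) f (X x)) (hf' : mfderiv (𝓡 2) 𝓘(ℝ, F) f (X x) = f')
    (hX : MDifferentiableAt 𝓘(ℝ, ℝ × ℝ) (𝓡 2) X x) :
    HasFDerivAt (fun y => f (X y)) (f'.comp (paramDeriv X x)) x := by
  subst hf'
  exact hasMFDerivAt_iff_hasFDerivAt.1 (hf.hasMFDerivAt.comp x hX.hasMFDerivAt)

theorem hasDerivAt_comp_left {F : Type*} [NormedAddCommGroup F] [NormedSpace ℝ F]
    {f : ℝ × ℝ → F} {f' : ℝ × ℝ →L[ℝ] F} {s t : ℝ} (hf : HasFDerivAt f f' (s, t)) :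
    HasDerivAt (fun s => f (s, t)) (f' (1, 0)) s :=
  hf.comp_hasDerivAt s ((hasDerivAt_id s).prodMk (hasDerivAt_const s t))

theorem hasDerivAt_comp_right {F : Type*} [NormedAddCommGroup F] [NormedSpace ℝ F]
    {f : ℝ × ℝ → F} {f' : ℝ × ℝ →L[ℝ] F} {s t : ℝ} (hf : HasFDerivAt f f' (s, t)) :
    HasDerivAt (fun t => f (s, t)) (f' (0, 1)) t :=
  hf.comp_hasDerivAt t ((hasDerivAt_const t s).prodMk (hasDerivAt_id t))

/-- A parametrization of a piece of `S` by the rotations of a profile curve. -/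
structure IsRotationParam (S : ImmersedSurface M) (q e₁ e₂ : L4) (I : Set ℝ)
    (r h c d k : ℝ → ℝ) (X : ℝ × ℝ → M) : Prop where
  frame : IsAxisFrame q e₁ e₂
  isOpen : IsOpen I
  profile : IsProfile I r c d k
  hasDerivAt_h : ∀ s ∈ I, HasDerivAt h (d s) s
  mdiff : ∀ s ∈ I, ∀ t, MDifferentiableAt 𝓘(ℝ, ℝ × ℝ) (𝓡 2) X (s, t)
  map_eq : ∀ s ∈ I, ∀ t, S.map (X (s, t)) = position q (radial e₁ e₂ t) (r s) + h s • xi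

namespace IsRotationParam

variable {S : ImmersedSurface M} {q e₁ e₂ : L4} {I : Set ℝ} {r h c d k : ℝ → ℝ} {X : ℝ × ℝ → M}
  {s t : ℝ}

/-- The unit normal of the rotational surface determined by the profile. -/
def stdNormal (q e₁ e₂ : L4) (r c d : ℝ → ℝ) (x : ℝ × ℝ) : L4 :=
  c x.1 • xi - d x.1 • outward q (radial e₁ e₂ x.2) (r x.1)

/-- The sign of the normal of `S` with respect to `stdNormal`. -/
def orientation (S : ImmersedSurface M) (q e₁ e₂ : L4) (r c d : ℝ → ℝ) (X : ℝ × ℝ → M)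
    (x : ℝ × ℝ) : ℝ :=
  lor (S.normal (X x)) (stdNormal q e₁ e₂ r c d x)

theorem hasFDerivAt_map (R : IsRotationParam S q e₁ e₂ I r h c d k X) (hs : s ∈ I) (t : ℝ) :
    HasFDerivAt (fun y => S.map (X y))
      ((S.mapDeriv (X (s, t))).comp (paramDeriv X (s, t))) (s, t) :=
  hasFDerivAt_comp_param ((S.map_smooth _).mdifferentiableAt (by simp)) rfl (R.mdiff s hs t)

theorem hasFDerivAt_normal (R : IsRotationParam S q e₁ e₂ I r h c d k X) (hs : s ∈ I) (t : ℝ) :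
    HasFDerivAt (fun y => S.normal (X y))
      ((S.normalDeriv (X (s, t))).comp (paramDeriv X (s, t))) (s, t) :=
  hasFDerivAt_comp_param ((S.normal_smooth _).mdifferentiableAt (by simp)) rfl (R.mdiff s hs t)

theorem mapDeriv_meridian (R : IsRotationParam S q e₁ e₂ I r h c d k X) (hs : s ∈ I) (t : ℝ) :
    S.mapDeriv (X (s, t)) (paramDeriv X (s, t) (1, 0)) =
      c s • outward q (radial e₁ e₂ t) (r s) + d s • xi := by
  refine (hasDerivAt_comp_left (R.hasFDerivAt_map hs t)).unique ?_
  have h1 := (hasDerivAt_position (q := q) (radial e₁ e₂ t) (R.profile.1 s hs)).add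
    ((R.hasDerivAt_h s hs).smul_const xi)
  refine h1.congr_of_eventuallyEq ?_
  filter_upwards [R.isOpen.mem_nhds hs] with x hx using R.map_eq x hx t

theorem mapDeriv_parallel (R : IsRotationParam S q e₁ e₂ I r h c d k X) (hs : s ∈ I) (t : ℝ) :
    S.mapDeriv (X (s, t)) (paramDeriv X (s, t) (0, 1)) =
      Real.sinh (r s) • angular e₁ e₂ t := by
  refine (hasDerivAt_comp_right (R.hasFDerivAt_map hs t)).unique ?_
  have h1 : HasDerivAt (fun t => position q (radial e₁ e₂ t) (r s) + h s • xi)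
      (Real.sinh (r s) • angular e₁ e₂ t) t :=
    (((hasDerivAt_radial t).const_smul (Real.sinh (r s))).add_const _).add_const _
  exact h1.congr_of_eventuallyEq (Eventually.of_forall fun x => R.map_eq s hs x)

/-- On the axis the image of the parallel has zero velocity. The immersion has injective
differential, so the parallel has zero velocity in `M` as well and is constant in charts. -/
theorem apply_eq_of_pole [T2Space M] [IsManifold (𝓡 2) ∞ M]
    (R : IsRotationParam S q e₁ e₂ I r h c d k X) (hs : s ∈ I) (hr : r s = 0) (t t' : ℝ) :
    X (s, t) = X (s, t') := by
  have hzero : ∀ t, paramDeriv X (s, t) (0, 1) = 0 := fun t => by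
    apply S.immersion (X (s, t))
    have := R.mapDeriv_parallel hs t
    rw [hr, Real.sinh_zero, zero_smul] at this
    exact this.trans (map_zero (S.mapDeriv (X (s, t)))).symm
  have hcont : ∀ t, ContinuousAt (fun t => X (s, t)) t := fun t =>
    ContinuousAt.comp (f := fun t => (s, t)) (R.mdiff s hs t).continuousAt (by fun_prop)
  have hloc : IsLocallyConstant fun t => X (s, t) := by
    rw [IsLocallyConstant.iff_eventually_eq]
    intro t₀
    have : IsManifold (𝓡 2) 1 M := IsManifold.of_le (n := ∞) (by simp)
    set f := extChartAt (𝓡 2) (X (s, t₀)) with hf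
    have hsrc : ∀ᶠ t in 𝓝 t₀, X (s, t) ∈ f.source :=
      (hcont t₀).eventually (extChartAt_source_mem_nhds (I := 𝓡 2) (X (s, t₀)))
    obtain ⟨δ, hδ, hball⟩ := Metric.eventually_nhds_iff_ball.1 hsrc
    have hd : ∀ t ∈ Metric.ball t₀ δ, HasDerivAt (fun t => f (X (s, t))) 0 t := fun t ht => by
      have hm : MDifferentiableAt (𝓡 2) 𝓘(ℝ, EuclideanSpace ℝ (Fin 2)) f (X (s, t)) :=
        mdifferentiableAt_extChartAt (by simpa [hf] using hball t ht)
      obtain ⟨f', hf'⟩ : ∃ f' : EuclideanSpace ℝ (Fin 2) →L[ℝ] EuclideanSpace ℝ (Fin 2),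
        mfderiv (𝓡 2) 𝓘(ℝ, EuclideanSpace ℝ (Fin 2)) f (X (s, t)) = f' := ⟨_, rfl⟩
      have h1 := hasDerivAt_comp_right (hasFDerivAt_comp_param hm hf' (R.mdiff s hs t))
      rw [ContinuousLinearMap.comp_apply, hzero t, map_zero] at h1
      exact h1
    have hconst : ∀ t ∈ Metric.ball t₀ δ, f (X (s, t)) = f (X (s, t₀)) := fun t ht =>
      Metric.isOpen_ball.is_const_of_deriv_eq_zero (convex_ball t₀ δ).isPreconnected
        (fun x hx => (hd x hx).differentiableAt.differentiableWithinAt)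
        (fun x hx => (hd x hx).deriv) ht (Metric.mem_ball_self hδ)
    filter_upwards [Metric.ball_mem_nhds t₀ hδ] with t ht
    exact f.injOn (hball t ht) (mem_extChartAt_source (I := 𝓡 2) (X (s, t₀))) (hconst t ht)
  exact hloc.apply_eq_of_preconnectedSpace t t'

theorem normal_eq [T2Space M] [IsManifold (𝓡 2) ∞ M]
    (R : IsRotationParam S q e₁ e₂ I r h c d k X) (hs : s ∈ I) (t : ℝ) (hd : r s = 0 → d s = 0) :
    orientation S q e₁ e₂ r c d X (s, t) ^ 2 = 1 ∧
      S.normal (X (s, t)) =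
        orientation S q e₁ e₂ r c d X (s, t) • stdNormal q e₁ e₂ r c d (s, t) := by
  have F := R.frame.rotate t
  refine F.eq_smul_normal (R.profile.5 s hs) ?_ ?_ ?_ (S.normal_unit _)
  · have h1 := S.normal_tangent (X (s, t))
    rw [horizontalPart_eq, R.map_eq s hs t] at h1
    have h2 : (position q (radial e₁ e₂ t) (r s) + h s • xi) 3 = h s := by
      have := (F.lor_adapted (r s)).2.2.2.2.2.1
      rw [lor_xi] at this
      simp [this, xi]
    rwa [h2, add_sub_cancel_right] at h1
  -- At a pole the parallel gives no direction; the meridian at angle t + π/2 passes through the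
  -- same point of `M`, with tangent along `angular`.
  · by_cases hr : r s = 0
    · have hc : c s ≠ 0 := fun h0 => by
        have := R.profile.5 s hs
        rw [h0, hd hr] at this; norm_num at this
      have h1 := R.mapDeriv_meridian hs (t + Real.pi / 2)
      have h2 := S.normal_orth (X (s, t + Real.pi / 2)) (paramDeriv X (s, t + Real.pi / 2) (1, 0))
      have h3 : lor (S.normal (X (s, t + Real.pi / 2))) (S.mapDeriv (X (s, t + Real.pi / 2))
        (paramDeriv X (s, t + Real.pi / 2) (1, 0))) = 0 := h2
      have h4 : radial e₁ e₂ (t + Real.pi / 2) = angular e₁ e₂ t := by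
        simp [radial, angular, Real.cos_add_pi_div_two, Real.sin_add_pi_div_two]
      rw [h1, R.apply_eq_of_pole hs hr _ t, hd hr, hr, h4] at h3
      simpa [outward, lor_smul_right, hc] using h3
    · have h2 : lor (S.normal (X (s, t))) (S.mapDeriv (X (s, t)) (paramDeriv X (s, t) (0, 1))) = 0 :=
        S.normal_orth (X (s, t)) (paramDeriv X (s, t) (0, 1))
      rw [R.mapDeriv_parallel hs t, lor_smul_right] at h2
      exact (mul_eq_zero.1 h2).resolve_left (by simpa using hr)
  · have h2 : lor (S.normal (X (s, t))) (S.mapDeriv (X (s, t)) (paramDeriv X (s, t) (1, 0))) = 0 :=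
      S.normal_orth (X (s, t)) (paramDeriv X (s, t) (1, 0))
    rwa [R.mapDeriv_meridian hs t] at h2

theorem continuousAt_stdNormal (R : IsRotationParam S q e₁ e₂ I r h c d k X) (hs : s ∈ I) (t : ℝ) :
    ContinuousAt (stdNormal q e₁ e₂ r c d) (s, t) := by
  have h1 : ContinuousAt (fun x : ℝ × ℝ => r x.1) (s, t) :=
    ContinuousAt.comp (f := Prod.fst) (R.profile.1 s hs).continuousAt continuousAt_fst
  have h2 : ContinuousAt (fun x : ℝ × ℝ => c x.1) (s, t) :=
    ContinuousAt.comp (f := Prod.fst) (R.profile.2 s hs).continuousAt continuousAt_fst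
  have h3 : ContinuousAt (fun x : ℝ × ℝ => d x.1) (s, t) :=
    ContinuousAt.comp (f := Prod.fst) (R.profile.3 s hs).continuousAt continuousAt_fst
  have h4 : ContinuousAt (fun x : ℝ × ℝ => radial e₁ e₂ x.2) (s, t) :=
    (continuous_radial.comp continuous_snd).continuousAt
  exact (h2.smul continuousAt_const).sub (h3.smul (((Real.continuous_cosh.continuousAt.comp h1).smul
    h4).add ((Real.continuous_sinh.continuousAt.comp h1).smul continuousAt_const)))

theorem continuousAt_orientation (R : IsRotationParam S q e₁ e₂ I r h c d k X) (hs : s ∈ I)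
    (t : ℝ) : ContinuousAt (orientation S q e₁ e₂ r c d X) (s, t) :=
  ContinuousAt.comp (f := fun x => (S.normal (X x), stdNormal q e₁ e₂ r c d x))
    continuous_lor.continuousAt
    ((R.hasFDerivAt_normal hs t).continuousAt.prodMk (R.continuousAt_stdNormal hs t))

/-- The sign is continuous with values ±1, hence locally constant; the normal can then be
differentiated with a fixed sign. -/
theorem eventually_normal_eq [T2Space M] [IsManifold (𝓡 2) ∞ M]
    (R : IsRotationParam S q e₁ e₂ I r h c d k X) (hs : s ∈ I) (t : ℝ)
    (hd : ∀ᶠ s in 𝓝 s, r s = 0 → d s = 0) :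
    ∀ᶠ x in 𝓝 (s, t), S.normal (X x) =
      orientation S q e₁ e₂ r c d X (s, t) • stdNormal q e₁ e₂ r c d x := by
  have h1 : ∀ᶠ x : ℝ × ℝ in 𝓝 (s, t), x.1 ∈ I ∧ (r x.1 = 0 → d x.1 = 0) := by
    have := hd.and (R.isOpen.mem_nhds hs)
    filter_upwards [continuousAt_fst.eventually this] with x hx using ⟨hx.2, hx.1⟩
  have h2 := (R.continuousAt_orientation hs t).eventually (Metric.ball_mem_nhds _ one_pos)
  have h0 := (R.normal_eq hs t hd.self_of_nhds).1
  filter_upwards [h1, h2] with x hx hx2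
  obtain ⟨h3, h4⟩ := R.normal_eq hx.1 x.2 hx.2
  have h5 : orientation S q e₁ e₂ r c d X (x.1, x.2) = orientation S q e₁ e₂ r c d X (s, t) := by
    change dist (orientation S q e₁ e₂ r c d X (x.1, x.2)) _ < 1 at hx2
    rw [Real.dist_eq, abs_lt] at hx2
    rcases sq_eq_one_iff.1 h3 with h | h <;>
      rcases sq_eq_one_iff.1 h0 with h' | h' <;> rw [h, h'] at hx2 ⊢ <;>
      norm_num at hx2
  rw [← h5]; exact h4

/-- The term along `position` is normal to ℍ² × ℝ and drops out of the second fundamental form; the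
other term gives the principal curvature ±k. -/
theorem normalDeriv_meridian [T2Space M] [IsManifold (𝓡 2) ∞ M]
    (R : IsRotationParam S q e₁ e₂ I r h c d k X) (hs : s ∈ I) (t : ℝ)
    (hd : ∀ᶠ s in 𝓝 s, r s = 0 → d s = 0) :
    S.normalDeriv (X (s, t)) (paramDeriv X (s, t) (1, 0)) =
      -(orientation S q e₁ e₂ r c d X (s, t) * k s) •
        (c s • outward q (radial e₁ e₂ t) (r s) + d s • xi) -
      (orientation S q e₁ e₂ r c d X (s, t) * (c s * d s)) •
        position q (radial e₁ e₂ t) (r s) := by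
  refine (hasDerivAt_comp_left (R.hasFDerivAt_normal hs t)).unique ?_
  have h1 := (((R.profile.2 s hs).smul_const xi).sub ((R.profile.3 s hs).smul
    (hasDerivAt_outward (q := q) (radial e₁ e₂ t) (R.profile.1 s hs)))).const_smul
    (orientation S q e₁ e₂ r c d X (s, t))
  refine (h1.congr_of_eventuallyEq ?_).congr_deriv ?_
  · exact (show ContinuousAt (fun s => (s, t)) s by fun_prop).eventually
      (R.eventually_normal_eq hs t hd)
  · module

theorem normalDeriv_parallel [T2Space M] [IsManifold (𝓡 2) ∞ M]
    (R : IsRotationParam S q e₁ e₂ I r h c d k X) (hs : s ∈ I) (t : ℝ)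
    (hd : ∀ᶠ s in 𝓝 s, r s = 0 → d s = 0) :
    S.normalDeriv (X (s, t)) (paramDeriv X (s, t) (0, 1)) =
      -(orientation S q e₁ e₂ r c d X (s, t) * (d s * Real.cosh (r s))) • angular e₁ e₂ t := by
  refine (hasDerivAt_comp_right (R.hasFDerivAt_normal hs t)).unique ?_
  have h0 : HasDerivAt (fun t => outward q (radial e₁ e₂ t) (r s))
      (Real.cosh (r s) • angular e₁ e₂ t) t :=
    ((hasDerivAt_radial t).const_smul (Real.cosh (r s))).add_const _
  have h1 := ((h0.const_smul (d s)).const_sub (c s • xi)).const_smul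
    (orientation S q e₁ e₂ r c d X (s, t))
  refine (h1.congr_of_eventuallyEq ?_).congr_deriv ?_
  · exact (show ContinuousAt (fun t => (s, t)) t by fun_prop).eventually
      (R.eventually_normal_eq hs t hd)
  · module

/-- The principal curvatures of a rotational surface off the axis. -/
theorem curvatures_of_ne_zero [T2Space M] [IsManifold (𝓡 2) ∞ M]
    (R : IsRotationParam S q e₁ e₂ I r h c d k X) (hs : s ∈ I) (t : ℝ) (hr : r s ≠ 0)
    {ε : ℝ} (hε : ε = orientation S q e₁ e₂ r c d X (s, t)) :
    S.meanCurvature (X (s, t)) = (ε * k s + ε * parallelCurv r d k s) / 2 ∧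
      S.extrinsicCurvature (X (s, t)) = ε * k s * (ε * parallelCurv r d k s) ∧
      S.secondFormNorm (X (s, t)) =
        Real.sqrt ((ε * k s) ^ 2 + (ε * parallelCurv r d k s) ^ 2) := by
  have hd : ∀ᶠ s in 𝓝 s, r s = 0 → d s = 0 := by
    filter_upwards [(R.profile.1 s hs).continuousAt.eventually_ne hr] with x hx h using absurd h hx
  have F := R.frame.rotate t
  obtain ⟨l1, l2, l3, l4, l5, l6, -⟩ := F.lor_adapted (r s)
  obtain ⟨-, -, -, h23, -, -, -, h22, -⟩ := F
  have l7 : lor xi (outward q (radial e₁ e₂ t) (r s)) = 0 := by rw [lor_comm]; exact l3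
  have l8 : lor (angular e₁ e₂ t) (outward q (radial e₁ e₂ t) (r s)) = 0 := by
    rw [lor_comm]; exact l2
  have l9 : lor xi xi = 1 := by rw [lor_xi, xi_three]
  have l10 : lor (angular e₁ e₂ t) xi = 0 := by rw [lor_xi, h23]
  have l11 : lor xi (angular e₁ e₂ t) = 0 := by rw [xi_lor, h23]
  have hcd := R.profile.5 s hs
  have hsh : Real.sinh (r s) ≠ 0 := by simpa using hr
  have m0 := R.mapDeriv_meridian hs t
  have m1 := R.mapDeriv_parallel hs t
  have n0 := R.normalDeriv_meridian hs t hd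
  have n1 := R.normalDeriv_parallel hs t hd
  rw [← hε] at n0 n1
  have hK : ε * parallelCurv r d k s * Real.sinh (r s) = ε * (d s * Real.cosh (r s)) := by
    rw [parallelCurv_of_ne hr]; field_simp
  refine S.curvatures_of_principal (X (s, t))
    ![paramDeriv X (s, t) (1, 0), paramDeriv X (s, t) (0, 1)]
    ![ε * k s, ε * parallelCurv r d k s] ?_ ?_
  · simp only [Matrix.cons_val_zero, Matrix.cons_val_one, m0, m1, lor_add_left, lor_add_right,
      lor_smul_left, lor_smul_right, l1, l2, l3, l7, l9, l11, h22]
    have : Real.sinh (r s) ^ 2 ≠ 0 := pow_ne_zero 2 hsh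
    convert this using 1
    linear_combination Real.sinh (r s) ^ 2 * hcd
  · intro i j
    fin_cases i <;> fin_cases j <;>
    simp only [Fin.zero_eta, Fin.mk_one, Matrix.cons_val_zero, Matrix.cons_val_one, m0, m1, n0, n1,
      lor_add_left, lor_add_right, lor_sub_left,
      lor_smul_left, lor_smul_right, l1, l2, l3, l4, l5, l6, l7, l8, l9, l10, l11, h22]
    · ring
    · ring
    · ring
    · linear_combination -Real.sinh (r s) * hK

/-- At the points on the axis, a rotational surface is umbilic. -/
theorem curvatures_of_pole [T2Space M] [IsManifold (𝓡 2) ∞ M]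
    (R : IsRotationParam S q e₁ e₂ I r h c d k X) (hs : s ∈ I) (t : ℝ) (hr : r s = 0)
    (hd : ∀ᶠ s in 𝓝 s, r s = 0 → d s = 0)
    {ε : ℝ} (hε : ε = orientation S q e₁ e₂ r c d X (s, 0)) :
    S.meanCurvature (X (s, t)) = (ε * k s + ε * k s) / 2 ∧
      S.extrinsicCurvature (X (s, t)) = ε * k s * (ε * k s) ∧
      S.secondFormNorm (X (s, t)) = Real.sqrt ((ε * k s) ^ 2 + (ε * k s) ^ 2) := by
  have hd0 := hd.self_of_nhds hr
  -- The meridians at angles 0 and π/2 give an orthogonal basis at the pole. They carry the same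
  -- sign, because the point of `M` is the same and the standard normal there is c ξ.
  have hε' : ε = orientation S q e₁ e₂ r c d X (s, Real.pi / 2) := by
    rw [hε]
    simp only [orientation, stdNormal, hd0, zero_smul, R.apply_eq_of_pole hs hr (Real.pi / 2) 0]
  have m0 := R.mapDeriv_meridian hs 0
  have m1 := R.mapDeriv_meridian hs (Real.pi / 2)
  have n0 := R.normalDeriv_meridian hs 0 hd
  have n1 := R.normalDeriv_meridian hs (Real.pi / 2) hd
  rw [← hε] at n0
  rw [← hε'] at n1
  rw [R.apply_eq_of_pole hs hr _ t] at m0 m1 n0 n1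
  have hcd := R.profile.5 s hs
  simp only [hr, hd0, outward, position, radial, Real.cosh_zero, Real.sinh_zero, Real.cos_zero,
    Real.sin_zero, Real.cos_pi_div_two, Real.sin_pi_div_two, one_smul, zero_smul, add_zero,
    zero_add, mul_zero, sub_zero] at m0 m1 n0 n1
  obtain ⟨-, -, -, -, -, -, h11, h22, h12⟩ := R.frame
  have h21 : lor e₂ e₁ = 0 := by rw [lor_comm]; exact h12
  rw [hd0] at hcd
  refine S.curvatures_of_principal (X (s, t))
    ![paramDeriv X (s, 0) (1, 0), paramDeriv X (s, Real.pi / 2) (1, 0)]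
    ![ε * k s, ε * k s] ?_ ?_
  · simp only [Matrix.cons_val_zero, Matrix.cons_val_one, m0, m1,
      lor_smul_left, lor_smul_right, h11, h22, h12]
    have : (1 : ℝ) ≠ 0 := one_ne_zero
    convert this using 1
    linear_combination (c s ^ 2 + 1) * hcd
  · intro i j
    fin_cases i <;> fin_cases j <;>
    simp only [Fin.zero_eta, Fin.mk_one, Matrix.cons_val_zero, Matrix.cons_val_one, m0, m1, n0, n1,
      lor_smul_left, lor_smul_right, h11, h22, h12, h21] <;> ring

end IsRotationParam

/-- Differentiating the unit speed condition gives r'r'' + h'h'' = 0, so the acceleration is k times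
the normal (-h', r'). -/
theorem isProfile_of_unit_speed {I : Set ℝ} {r h : ℝ → ℝ} (hI : IsOpen I)
    (hr : ContDiffOn ℝ ∞ r I) (hh : ContDiffOn ℝ ∞ h I)
    (hu : ∀ s ∈ I, deriv r s ^ 2 + deriv h s ^ 2 = 1) :
    IsProfile I r (deriv r) (deriv h)
      fun s => deriv r s * deriv (deriv h) s - deriv h s * deriv (deriv r) s := by
  have smooth : ∀ {f : ℝ → ℝ}, ContDiffOn ℝ ∞ f I → ContDiffOn ℝ ∞ (deriv f) I :=
    fun hf => hf.deriv_of_isOpen hI (by simp)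
  have diff : ∀ {f : ℝ → ℝ}, ContDiffOn ℝ ∞ f I → ∀ s ∈ I, DifferentiableAt ℝ f s :=
    fun hf s hs => (hf.contDiffAt (hI.mem_nhds hs)).differentiableAt (by simp)
  have hrel : ∀ s ∈ I, deriv r s * deriv (deriv r) s + deriv h s * deriv (deriv h) s = 0 := by
    intro s hs
    have h1 := ((diff (smooth hr) s hs).hasDerivAt.fun_pow 2).fun_add
      ((diff (smooth hh) s hs).hasDerivAt.fun_pow 2)
    have h2 : (fun s => deriv r s ^ 2 + deriv h s ^ 2) =ᶠ[𝓝 s] fun _ => (1 : ℝ) := by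
      filter_upwards [hI.mem_nhds hs] with x hx using hu x hx
    have h3 := h1.unique ((hasDerivAt_const s (1 : ℝ)).congr_of_eventuallyEq h2)
    norm_num at h3
    linarith
  refine ⟨fun s hs => (diff hr s hs).hasDerivAt, fun s hs => ?_, fun s hs => ?_, fun s hs => ?_, hu⟩
  · refine (diff (smooth hr) s hs).hasDerivAt.congr_deriv ?_
    linear_combination -deriv (deriv r) s * hu s hs + deriv r s * hrel s hs
  · refine (diff (smooth hh) s hs).hasDerivAt.congr_deriv ?_
    linear_combination -deriv (deriv h) s * hu s hs + deriv h s * hrel s hs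
  · exact ((diff (smooth hr) s hs).mul (diff (smooth (smooth hh)) s hs)).sub
      ((diff (smooth hh) s hs).mul (diff (smooth (smooth hr)) s hs))

namespace IsRotationParam

variable {M : Type u} [TopologicalSpace M] [ChartedSpace (EuclideanSpace ℝ (Fin 2)) M]
  {S : ImmersedSurface M} {q e₁ e₂ : L4} {I : Set ℝ} {r h c d k : ℝ → ℝ} {X : ℝ × ℝ → M}

/-- The profile of a rotational Weingarten surface satisfies the Weingarten relation. -/
theorem arcRelation [T2Space M] [IsManifold (𝓡 2) ∞ M]
    (R : IsRotationParam S q e₁ e₂ I r h c d k X) {φ : ℝ → ℝ} (hφ : IsElliptic φ)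
    (hW : S.IsWeingarten φ) : IsProfile.ArcRelation |φ 0| I r d k := by
  intro a b hab hr
  set ε : ℝ → ℝ := fun s => orientation S q e₁ e₂ r c d X (s, 0) with hε
  have hsub : Ioo a b ⊆ I := Ioo_subset_Icc_self.trans hab
  have hrel : ∀ s ∈ Ioo a b,
      (ε s * k s + ε s * parallelCurv r d k s) / 2 = φ (((k s - parallelCurv r d k s) / 2) ^ 2) := by
    intro s hs
    obtain ⟨h1, h2, -⟩ := R.curvatures_of_ne_zero (hsub hs) 0 (hr s hs) (ε := ε s) rfl
    have h3 := hW (X (s, 0))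
    have h4 : ε s ^ 2 = 1 := (R.normal_eq (hsub hs) 0 fun h => absurd h (hr s hs)).1
    rw [h1, h2] at h3
    rw [h3]
    congr 1
    linear_combination ((k s - parallelCurv r d k s) / 2) ^ 2 * h4
  have hcont : ContinuousOn ε (Ioo a b) := fun s hs =>
    (ContinuousAt.comp (f := fun s => (s, (0 : ℝ))) (R.continuousAt_orientation (hsub hs) 0)
      (by fun_prop)).continuousWithinAt
  -- The sign of the normal is constant on an arc off the axis and decides between φ(u²) and -φ(u²).
  rcases isPreconnected_Ioo.eq_one_or_eq_neg_one_of_sq_eq hcont (fun s hs =>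
    (R.normal_eq (hsub hs) 0 fun h => absurd h (hr s hs)).1) with h1 | h1
  · refine ⟨_, hφ.isEllipticRelation, by norm_num, fun s hs => ?_⟩
    have h2 := hrel s hs
    rw [h1 hs] at h2
    simpa [RelationAt] using h2
  · refine ⟨_, hφ.isEllipticRelation_neg, by norm_num, fun s hs => ?_⟩
    have h2 := hrel s hs
    rw [h1 hs] at h2
    simp only [RelationAt, ← h2, Pi.neg_apply, Pi.one_apply]
    ring

end IsRotationParam

theorem sqrt_sq_add_sq_le {x y C : ℝ} (hx : |x| ≤ C) (hy : |y| ≤ C) :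
    Real.sqrt (x ^ 2 + y ^ 2) ≤ 2 * C := by
  rw [Real.sqrt_le_left (by linarith [abs_nonneg x])]
  nlinarith [sq_le_sq' (neg_le_of_abs_le hx) (le_of_abs_le hx),
    sq_le_sq' (neg_le_of_abs_le hy) (le_of_abs_le hy), sq_nonneg C]

end WeingartenH2R

end

/-! ### Conclusion. -/

open WeingartenH2R WeingartenH2R.IsRotationParam WeingartenH2R.IsAxisFrame in
theorem proposition8p1 (φ : ℝ → ℝ) (hφ : WeingartenH2R.IsElliptic φ)
    (M : Type u) [TopologicalSpace M] [ChartedSpace (EuclideanSpace ℝ (Fin 2)) M]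
    [IsManifold (𝓡 2) ∞ M] [T2Space M] [SecondCountableTopology M] [ConnectedSpace M]
    (S : WeingartenH2R.ImmersedSurface M) (hS : S.IsCanonicalExample φ) :
    ∃ C : ℝ, ∀ p : M, S.secondFormNorm p ≤ C := by
  obtain ⟨hW, q, ⟨e₁, e₂, I, r, h, X, F, hI, hI', hr, hh, hu, hX, -, hmap, hsurj⟩,
    ⟨p, ⟨h₀, hp⟩, horth⟩, -⟩ := hS
  have R : IsRotationParam S q e₁ e₂ I r h (deriv r) (deriv h) _ X :=
    { frame := F
      isOpen := hI
      profile := isProfile_of_unit_speed hI hr hh hu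
      hasDerivAt_h := fun s hs =>
        ((hh.contDiffAt (hI.mem_nhds hs)).differentiableAt (by simp)).hasDerivAt
      mdiff := fun s hs t => (hX.contMDiffAt ((hI.prod isOpen_univ).mem_nhds
        ⟨hs, Set.mem_univ t⟩)).mdifferentiableAt (by simp)
      map_eq := fun s hs t => by rw [hmap s hs t, F.axisRotation_planePoint] }
  have mem : ∀ p : M, ∃ s ∈ I, ∃ t, X (s, t) = p := fun p => by
    have hp : p ∈ X '' (I ×ˢ Set.univ) := hsurj ▸ Set.mem_univ p
    obtain ⟨⟨s, t⟩, hx, rfl⟩ := hp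
    exact ⟨s, hx.1, t, rfl⟩
  obtain ⟨s₀, hs₀, t₀, rfl⟩ := mem p
  have adapted := (F.rotate t₀).lor_adapted (r s₀)
  -- The product with `q` turns the position of the contact point into cosh r = 1.
  have hr₀ : r s₀ = 0 := by
    rw [R.map_eq s₀ hs₀ t₀] at hp
    have h1 := congrArg (fun x => lor x q) hp
    simp only [lor_add_left, lor_smul_left, xi_lor, F.2.1, adapted.2.2.2.2.2.2, F.lor_base] at h1
    by_contra h0
    linarith [Real.one_lt_cosh.2 h0]
  have hd₀ : deriv h s₀ = 0 := by
    have h1 : lor (S.mapDeriv (X (s₀, t₀)) (paramDeriv X (s₀, t₀) (1, 0))) xi = 0 :=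
      horth (paramDeriv X (s₀, t₀) (1, 0))
    rw [R.mapDeriv_meridian hs₀ t₀] at h1
    simpa [lor_add_left, lor_smul_left, adapted.2.2.1, xi_lor, xi_three] using h1
  have key := fun s (hs : s ∈ I) =>
    R.profile.bounds hI hI' (R.arcRelation hφ hW) hs₀ hr₀ hd₀ hs
  refine ⟨2 * (1 + 4 * |φ 0|), fun p => ?_⟩
  obtain ⟨s, hs, t, rfl⟩ := mem p
  have habs : ∀ {ε x : ℝ}, ε ^ 2 = 1 → |ε * x| = |x| := fun {ε x} hε => by
    rcases sq_eq_one_iff.1 hε with rfl | rfl <;> simp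
  by_cases hrs : r s = 0
  · have hd : ∀ᶠ s in nhds s, r s = 0 → deriv h s = 0 := by
      filter_upwards [hI.mem_nhds hs] with x hx using (key x hx).1
    obtain ⟨h1, h2, h3⟩ := R.curvatures_of_pole hs t hrs hd rfl
    have h4 := hW (X (s, t))
    -- At a pole H² - K_e = 0, so both principal curvatures equal φ(0).
    rw [h1, h2, add_self_div_two, sq, sub_self] at h4
    rw [h3, h4]
    exact sqrt_sq_add_sq_le (by linarith [abs_nonneg (φ 0)]) (by linarith [abs_nonneg (φ 0)])
  · have h1 := (R.normal_eq hs t fun h => absurd h hrs).1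
    obtain ⟨h2, h3⟩ := (key s hs).2 hrs
    rw [(R.curvatures_of_ne_zero hs t hrs rfl).2.2]
    exact sqrt_sq_add_sq_le (by rwa [habs h1]) (by rwa [habs h1])
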